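/- **Setting.** Let $M$ be a smooth real manifold of dimension $n+1$ and let $\pi:M\to\mathbb R$ be a smooth surjective submersion. Let $\pi_{10}:J^1\pi\to M$, $\pi_{10}(j^1_t\gamma)=\gamma(t)$, be the bundle of first jets of local smooth sections of $\pi$. Charts $(t,x^i)$ of $M$ with $t=\pi$ induce charts $(t,x^i,y^i)$ of $J^1\pi$; write also $t$ for the function $\pi\circ\pi_{10}$ on $J^1\pi$, and let $J=\frac{\partial}{\partial y^i}\otimes(dx^i-y^i\,dt)$ be the vertical endomorphism of $J^1\pi$ (this does not depend on the chart). For a smooth $k$-form $\omega$ on $J^1\pi$ or on an open subset of it put $$(i_J\omega)(X_1,\dots,X_k)=\sum_{i=1}^k\omega(X_1,\dots,JX_i,\dots,X_k),\qquad d_J\omega=i_J\,d\omega-d\,i_J\omega$$ (so $i_J\omega=0$ for $k=0$). A smooth $k$-form $\theta$ is called * *$d_J$-closed (modulo $dt$)* if $d_J\theta\wedge dt=0$; * *$d_J$-exact (modulo $dt$)* on an open set $U\subseteq J^1\pi$ if there is a smooth $(k-1)$-form $\omega$ on $U$ with $\theta\wedge dt=d_J\omega\wedge dt$ on $U$ (for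 $k=0$ the only form of degree $-1$ is $0$, and the condition reads $\theta\wedge dt=0$); * *semi-basic*, for $k\ge1$, if $\theta(X_1,\dots,X_k)=0$ whenever one of the $X_i$ is vertical, i.e. lies in the kernel of the differential of $\pi_{10}$. **Lemma (Poincaré-type Lemma).** Let $\theta$ be a smooth $k$-form on $J^1\pi$. (i) If $\theta$ is $d_J$-exact (modulo $dt$) on $J^1\pi$, then $\theta$ is $d_J$-closed (modulo $dt$). (ii) If $k\ge1$ and $\theta$ is semi-basic and $d_J$-closed (modulo $dt$), then $\theta$ is locally $d_J$-exact (modulo $dt$): every point of $J^1\pi$ has an open neighbourhood on which $\theta$ is $d_J$-exact (modulo $dt$). -/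

import Mathlib

open scoped Manifold ContDiff Topology


noncomputable section

namespace JetForms

/-! ### Pointwise (multi)linear algebra -/

section Linear

variable {T : Type*} [AddCommGroup T] [Module ℝ T] [TopologicalSpace T]
  {k : ℕ}

/-- The algebraic derivation `i_A B (X₁, …, X_k) = ∑ᵢ B (X₁, …, A Xᵢ, …, X_k)` of an alternating
`k`-form `B` by an endomorphism `A` (it is `0` for `k = 0`). -/
def insertEndo (A : T →L[ℝ] T) (B : T [⋀^Fin k]→L[ℝ] ℝ) : T [⋀^Fin k]→L[ℝ] ℝ :=
  { (∑ i : Fin k, B.toContinuousMultilinearMap.compContinuousLinearMap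
      (fun j => if j = i then A else ContinuousLinearMap.id ℝ T)) with
    map_eq_zero_of_eq' := by
      intro v i j hij hne
      have key : ∀ l : Fin k, (fun m => (if m = l then A else ContinuousLinearMap.id ℝ T) (v m))
          = Function.update v l (A (v l)) := by
        intro l; funext m
        by_cases h : m = l
        · subst h; simp
        · simp [h]
      change (∑ l : Fin k, B.toContinuousMultilinearMap.compContinuousLinearMap
        (fun j => if j = l then A else ContinuousLinearMap.id ℝ T)) v = 0
      simp only [sum_apply,
        ContinuousMultilinearMap.compContinuousLinearMap_apply, key]
      rw [Finset.sum_eq_add i j hne]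
      · have h := B.map_swap (Function.update v i (A (v i))) hne
        have h2 : (Function.update v i (A (v i))) ∘ Equiv.swap i j
            = Function.update v j (A (v j)) := by
          funext m
          by_cases h1 : m = i
          · subst h1; simp [hne, hne.symm, hij]
          · by_cases h3 : m = j
            · subst h3; simp [hij]
            · simp [Equiv.swap_apply_of_ne_of_ne h1 h3, h1, h3]
        rw [h2] at h
        change B.toAlternatingMap _ + B.toAlternatingMap _ = 0
        rw [h]; simp
      · intro l _ hl
        exact B.map_eq_zero_of_eq _ (by simp [hl.1.symm, hl.2.symm, hij]) hne
      · simp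
      · simp }

theorem insertEndo_apply (A : T →L[ℝ] T) (B : T [⋀^Fin k]→L[ℝ] ℝ) (v : Fin k → T) :
    insertEndo A B v = ∑ i, B (Function.update v i (A (v i))) := by
  change (∑ l : Fin k, B.toContinuousMultilinearMap.compContinuousLinearMap
        (fun j => if j = l then A else ContinuousLinearMap.id ℝ T)) v = _
  simp only [sum_apply,
    ContinuousMultilinearMap.compContinuousLinearMap_apply]
  refine Finset.sum_congr rfl fun l _ => ?_
  change B _ = B _
  congr 1
  funext m
  by_cases h : m = l
  · subst h; simp
  · simp [h]

/-- The wedge product `η ∧ α` of an alternating `k`-form `η` with a linear form `α`: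
`(η ∧ α) (X₀, …, X_k) = (-1)^k ∑ᵢ (-1)^i α (Xᵢ) η (X₀, …, X̂ᵢ, …, X_k)`. -/
def wedgeOne (η : T [⋀^Fin k]→L[ℝ] ℝ) (α : T →L[ℝ] ℝ) : T [⋀^Fin (k + 1)]→L[ℝ] ℝ :=
  { AlternatingMap.alternatizeUncurryFin
      ((-1 : ℝ) ^ k • (α : T →ₗ[ℝ] ℝ).smulRight η.toAlternatingMap) with
    cont := by
      change Continuous fun v => (AlternatingMap.alternatizeUncurryFin
        ((-1 : ℝ) ^ k • (α : T →ₗ[ℝ] ℝ).smulRight η.toAlternatingMap)) v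
      simp only [AlternatingMap.alternatizeUncurryFin_apply]
      refine continuous_finsetSum _ fun i _ => ?_
      change Continuous fun v : Fin (k + 1) → T =>
        (-1 : ℤ) ^ (i : ℕ) • ((-1 : ℝ) ^ k • (α (v i) • η (i.removeNth v)))
      have h2 : Continuous fun v : Fin (k + 1) → T => i.removeNth v :=
        continuous_pi fun j => continuous_apply _
      exact (((α.continuous.comp (continuous_apply i)).smul (η.cont.comp h2)).const_smul
        ((-1 : ℝ) ^ k)).const_smul ((-1 : ℤ) ^ (i : ℕ)) }

theorem wedgeOne_apply (η : T [⋀^Fin k]→L[ℝ] ℝ) (α : T →L[ℝ] ℝ) (v : Fin (k + 1) → T) :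
    wedgeOne η α v =
      (-1) ^ k * ∑ i : Fin (k + 1), (-1) ^ (i : ℕ) * (α (v i) * η (i.removeNth v)) := by
  change (AlternatingMap.alternatizeUncurryFin
        ((-1 : ℝ) ^ k • (α : T →ₗ[ℝ] ℝ).smulRight η.toAlternatingMap)) v = _
  rw [AlternatingMap.alternatizeUncurryFin_apply, Finset.mul_sum]
  refine Finset.sum_congr rfl fun i _ => ?_
  change (-1 : ℤ) ^ (i : ℕ) • ((-1 : ℝ) ^ k • (α (v i) • η (i.removeNth v))) = _
  simp only [smul_eq_mul, zsmul_eq_mul]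
  push_cast
  ring

end Linear

/-! ### Differential forms on a smooth manifold without boundary -/

section Forms

variable {V : Type*} [NormedAddCommGroup V] [NormedSpace ℝ V]
  {P : Type*} [TopologicalSpace P] [ChartedSpace V P] {k : ℕ}

variable (V P) in
/-- Fields of alternating `k`-linear forms on the tangent spaces of `P`. -/
abbrev FormField (k : ℕ) : Type _ := (u : P) → TangentSpace 𝓘(ℝ, V) u [⋀^Fin k]→L[ℝ] ℝ

variable (V P) in
/-- `(1,1)`-tensor fields on `P`, i.e. vector valued `1`-forms. -/
abbrev EndoField : Type _ := (u : P) → TangentSpace 𝓘(ℝ, V) u →L[ℝ] TangentSpace 𝓘(ℝ, V) u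

variable (V P) in
/-- Fields of linear forms on the tangent spaces of `P`. -/
abbrev CovectorField : Type _ := (u : P) → TangentSpace 𝓘(ℝ, V) u →L[ℝ] ℝ

/-- The expression of a form in a chart `φ`: its pull-back by `φ⁻¹`. -/
def formInChart (φ : OpenPartialHomeomorph P V) (η : FormField V P k) :
    V → V [⋀^Fin k]→L[ℝ] ℝ := fun z =>
  (η (φ.symm z)).compContinuousLinearMap
    ((mfderiv 𝓘(ℝ, V) 𝓘(ℝ, V) φ.symm z).comp
      (NormedSpace.fromTangentSpace (𝕜 := ℝ) z).symm.toContinuousLinearMap)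

/-- A form is smooth on an open set `U` if its expression in every chart of the atlas is
`C^∞` on the part of the chart that lies in `U`. -/
def SmoothFormOn (η : FormField V P k) (U : Set P) : Prop :=
  ∀ φ ∈ atlas V P, ContDiffOn ℝ ∞ (formInChart φ η) (φ.target ∩ φ.symm ⁻¹' U)

/-- The exterior derivative, computed at `u` in the preferred chart at `u`. -/
def extD (η : FormField V P k) : FormField V P (k + 1) := fun u =>
  ContinuousAlternatingMap.compContinuousLinearMap
    (extDeriv (formInChart (chartAt V u) η) (chartAt V u u))
    (mvfderiv 𝓘(ℝ, V) (chartAt V u) u)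

/-- `i_A η`. -/
def insertField (A : EndoField V P) (η : FormField V P k) : FormField V P k := fun u =>
  insertEndo (A u) (η u)

/-- The exterior derivative with respect to a vector valued `1`-form: `d_A = i_A ∘ d - d ∘ i_A`. -/
def extDAlong (A : EndoField V P) (η : FormField V P k) : FormField V P (k + 1) :=
  fun u => insertField A (extD η) u - extD (insertField A η) u

/-- `θ` is `d_A`-closed (modulo `τ`): `d_A θ ∧ τ = 0`. -/
def IsClosedMod (A : EndoField V P) (τ : CovectorField V P) (θ : FormField V P k) : Prop :=
  ∀ u, wedgeOne (extDAlong A θ u) (τ u) = 0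

/-- `θ` is `d_A`-exact (modulo `τ`) on the open set `U`: there is a smooth form `η`, defined on `U`
and of degree one less, with `θ ∧ τ = d_A η ∧ τ` on `U`. There are no forms of degree `-1` but `0`,
so that for functions the condition reads `θ ∧ τ = 0`. (A form on `U` is represented by a field of
forms on `P` whose values outside `U` play no role.) -/
def IsExactModOn (A : EndoField V P) (τ : CovectorField V P) (U : Set P) :
    {k : ℕ} → FormField V P k → Prop
  | 0, θ => ∀ u ∈ U, wedgeOne (θ u) (τ u) = 0
  | k + 1, θ => ∃ η : FormField V P k, SmoothFormOn η U ∧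
      ∀ u ∈ U, wedgeOne (θ u) (τ u) = wedgeOne (extDAlong A η u) (τ u)

end Forms

/-! ### Manifolds fibred over `ℝ` and their first jet bundles -/

/-- The space `ℝ × ℝⁿ` of coordinates `(t, x)`. -/
abbrev BaseModel (n : ℕ) : Type := ℝ × EuclideanSpace ℝ (Fin n)

/-- The space `(ℝ × ℝⁿ) × ℝⁿ` of coordinates `((t, x), y)`. -/
abbrev JetModel (n : ℕ) : Type := BaseModel n × EuclideanSpace ℝ (Fin n)

/-- A fibration `π : M → ℝ` of an `(n+1)`-dimensional manifold: a smooth surjective submersion. -/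
structure FibredOverReal (n : ℕ) (M : Type*) [TopologicalSpace M]
    [ChartedSpace (BaseModel n) M] where
  proj : M → ℝ
  surjective : Function.Surjective proj
  submersion : Manifold.IsSubmersion 𝓘(ℝ, BaseModel n) 𝓘(ℝ, ℝ) ∞ proj

section Jets

variable {n : ℕ} {M : Type*} [TopologicalSpace M] [ChartedSpace (BaseModel n) M]
  [IsManifold 𝓘(ℝ, BaseModel n) ∞ M]

/-- `v = γ'(t)` for a smooth section `γ` of `π` defined on an open neighbourhood of `t`. As a first
jet `j¹_t γ` consists of `t`, `γ t` and the first derivative of `γ` at `t`, these vectors are the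
first jets of local sections. -/
def IsFirstJet (π : FibredOverReal n M) (v : TangentBundle 𝓘(ℝ, BaseModel n) M) : Prop :=
  ∃ (t : ℝ) (I : Set ℝ) (γ : ℝ → M), IsOpen I ∧ t ∈ I ∧
    ContMDiffOn 𝓘(ℝ, ℝ) 𝓘(ℝ, BaseModel n) ∞ γ I ∧ (∀ s ∈ I, π.proj (γ s) = s) ∧
    v = ⟨γ t, mfderiv 𝓘(ℝ, ℝ) 𝓘(ℝ, BaseModel n) γ t ((NormedSpace.fromTangentSpace t).symm 1)⟩

/-- The first jet bundle `J¹π`, realized inside the tangent bundle of `M`. -/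
def Jet (π : FibredOverReal n M) : Type _ := {v // IsFirstJet π v}

instance (π : FibredOverReal n M) : TopologicalSpace (Jet π) :=
  inferInstanceAs (TopologicalSpace {v // IsFirstJet π v})

variable {π : FibredOverReal n M}

/-- The projection `π₁₀ : J¹π → M`. -/
def Jet.base (u : Jet π) : M := u.1.1

/-- The derivative at `t` of a section with first jet `u`. -/
def Jet.vel (u : Jet π) : TangentSpace 𝓘(ℝ, BaseModel n) u.base := u.1.2

/-- Fibred charts `(t, x)` of `M`: the first coordinate is `π`. -/
def IsFibredChart (π : FibredOverReal n M) (e : OpenPartialHomeomorph M (BaseModel n)) : Prop :=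
  e ∈ IsManifold.maximalAtlas 𝓘(ℝ, BaseModel n) ∞ M ∧ ∀ p ∈ e.source, (e p).1 = π.proj p

theorem exists_isFibredChart (π : FibredOverReal n M) (p : M) :
    ∃ e, IsFibredChart π e ∧ p ∈ e.source := by
  obtain ⟨F, _, _, hF⟩ := π.submersion
  obtain ⟨φ, ψ, hp, -, hφ, hψ, hsrc, L, hL⟩ := hF p
  have : FiniteDimensional ℝ (ℝ × F) := L.toLinearEquiv.finiteDimensional
  have : FiniteDimensional ℝ F :=
    FiniteDimensional.of_surjective (LinearMap.snd ℝ ℝ F) LinearMap.snd_surjective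
  have hrk : Module.finrank ℝ F = Module.finrank ℝ (EuclideanSpace ℝ (Fin n)) := by
    have := L.toLinearEquiv.finrank_eq
    simp only [Module.finrank_prod, Module.finrank_self] at this
    omega
  let K : F ≃L[ℝ] EuclideanSpace ℝ (Fin n) := ContinuousLinearEquiv.ofFinrankEq hrk
  let L' : BaseModel n ≃L[ℝ] BaseModel n :=
    L.trans ((ContinuousLinearEquiv.refl ℝ ℝ).prodCongr K)
  have hL' : ∀ q ∈ φ.source, (L' (φ q)).1 = ψ (π.proj q) := by
    intro q hq
    have := hL (x := φ q) (by simpa using φ.map_source hq)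
    simp only [Function.comp_apply] at this
    have h2 : (φ.extend 𝓘(ℝ, BaseModel n)).symm (φ q) = q := by simp [φ.left_inv hq]
    rw [h2] at this
    exact this.symm
  let h : OpenPartialHomeomorph (BaseModel n) (BaseModel n) :=
    ψ.symm.prod (OpenPartialHomeomorph.refl (EuclideanSpace ℝ (Fin n)))
  let e : OpenPartialHomeomorph M (BaseModel n) :=
    (φ.trans L'.toHomeomorph.toOpenPartialHomeomorph).trans h
  have hval : ∀ q, e q = (ψ.symm (L' (φ q)).1, (L' (φ q)).2) := fun q => rfl
  have hsymm : ∀ z, e.symm z = φ.symm (L'.symm (ψ z.1, z.2)) := fun q => rfl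
  have hes : ∀ q, q ∈ e.source ↔ q ∈ φ.source := by
    intro q
    simp only [e, h, OpenPartialHomeomorph.trans_source, Set.mem_inter_iff]
    constructor
    · exact fun hq => hq.1.1
    · intro hq
      refine ⟨⟨hq, trivial⟩, ?_, trivial⟩
      change (L' (φ q)).1 ∈ ψ.target
      rw [hL' q hq]
      exact ψ.map_source (hsrc hq)
  have het : ∀ z, z ∈ e.target → z.1 ∈ ψ.source ∧ L'.symm (ψ z.1, z.2) ∈ φ.target := by
    intro z hz
    exact ⟨hz.1.1, hz.2.2⟩
  refine ⟨e, ⟨?_, ?_⟩, (hes p).2 hp⟩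
  · refine e.mem_maximalAtlas_of_contMDiffOn ?_ ?_
    · have h1 := contMDiffOn_of_mem_maximalAtlas hφ
      have h2 := contMDiffOn_symm_of_mem_maximalAtlas hψ
      have h3 : ContMDiffOn 𝓘(ℝ, BaseModel n) 𝓘(ℝ, BaseModel n) ∞
          (fun q => L' (φ q)) φ.source := L'.contDiff.contMDiff.comp_contMDiffOn h1
      have h4 : ContDiffOn ℝ ∞ (fun z : BaseModel n => (ψ.symm z.1, z.2))
          (Prod.fst ⁻¹' ψ.target) :=
        (h2.contDiffOn.comp contDiff_fst.contDiffOn fun z hz => hz).prodMk contDiff_snd.contDiffOn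
      exact (h4.contMDiffOn.comp (h3.mono fun q hq => (hes q).1 hq) fun q hq => by
        change (L' (φ q)).1 ∈ ψ.target
        rw [hL' q ((hes q).1 hq)]
        exact ψ.map_source (hsrc ((hes q).1 hq)))
    · have h1 := contMDiffOn_symm_of_mem_maximalAtlas hφ
      have h2 := contMDiffOn_of_mem_maximalAtlas hψ
      have h4 : ContDiffOn ℝ ∞ (fun z : BaseModel n => L'.symm (ψ z.1, z.2))
          (Prod.fst ⁻¹' ψ.source) :=
        L'.symm.contDiff.comp_contDiffOn
          ((h2.contDiffOn.comp contDiff_fst.contDiffOn fun z hz => hz).prodMk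
            contDiff_snd.contDiffOn)
      exact h1.comp (h4.contMDiffOn.mono fun z hz => (het z hz).1) fun z hz => (het z hz).2
  · intro q hq
    rw [hval, hL' q ((hes q).1 hq)]
    exact ψ.left_inv (hsrc ((hes q).1 hq))

theorem IsFibredChart.contMDiffOn {e : OpenPartialHomeomorph M (BaseModel n)}
    (he : IsFibredChart π e) :
    ContMDiffOn 𝓘(ℝ, BaseModel n) 𝓘(ℝ, BaseModel n) ∞ e e.source :=
  contMDiffOn_of_mem_maximalAtlas he.1

theorem IsFibredChart.contMDiffOn_symm {e : OpenPartialHomeomorph M (BaseModel n)}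
    (he : IsFibredChart π e) :
    ContMDiffOn 𝓘(ℝ, BaseModel n) 𝓘(ℝ, BaseModel n) ∞ e.symm e.target :=
  contMDiffOn_symm_of_mem_maximalAtlas he.1

theorem IsFibredChart.mdifferentiable {e : OpenPartialHomeomorph M (BaseModel n)}
    (he : IsFibredChart π e) : e.MDifferentiable 𝓘(ℝ, BaseModel n) 𝓘(ℝ, BaseModel n) :=
  ⟨he.contMDiffOn.mdifferentiableOn (by simp), he.contMDiffOn_symm.mdifferentiableOn (by simp)⟩

/-- In a fibred chart a jet has the velocity `(1, y)`. -/
theorem Jet.vel_fst {e : OpenPartialHomeomorph M (BaseModel n)} (he : IsFibredChart π e)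
    (u : Jet π) (hu : u.base ∈ e.source) :
    (mvfderiv 𝓘(ℝ, BaseModel n) e u.base u.vel).1 = 1 := by
  obtain ⟨v, t, I, γ, hI, htI, hγ, hs, rfl⟩ := u
  change γ t ∈ e.source at hu
  have hγt : MDifferentiableAt 𝓘(ℝ, ℝ) 𝓘(ℝ, BaseModel n) γ t :=
    (hγ.contMDiffAt (hI.mem_nhds htI)).mdifferentiableAt (by simp)
  have het := he.mdifferentiable.mdifferentiableAt hu
  have h1 := mfderiv_comp t het hγt
  have h2 : DifferentiableAt ℝ (e ∘ γ) t :=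
    (mdifferentiableAt_iff_differentiableAt).1 (het.comp t hγt)
  have h3 : HasFDerivAt (fun s => ((e ∘ γ) s).1)
      ((ContinuousLinearMap.fst ℝ ℝ _).comp (fderiv ℝ (e ∘ γ) t)) t :=
    (hasFDerivAt_fst).comp t h2.hasFDerivAt
  have h4 : (fun s => ((e ∘ γ) s).1) =ᶠ[𝓝 t] id := by
    have : ∀ᶠ s in 𝓝 t, γ s ∈ e.source :=
      hγt.continuousAt.eventually (e.open_source.mem_nhds hu)
    filter_upwards [this, hI.mem_nhds htI] with s h5 h6
    simp only [Function.comp_apply, id]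
    rw [he.2 _ h5, hs s h6]
  have h5 := (h3.congr_of_eventuallyEq h4.symm).unique (hasFDerivAt_id t)
  have h6 := congrArg (fun f : ℝ →L[ℝ] ℝ => f 1) h5
  have h7 : (fderiv ℝ (e ∘ γ) t) 1 = (mfderiv 𝓘(ℝ, BaseModel n) 𝓘(ℝ, BaseModel n) e (γ t))
      (mfderiv 𝓘(ℝ, ℝ) 𝓘(ℝ, BaseModel n) γ t (1 : ℝ)) := by
    rw [← mfderiv_eq_fderiv, h1]; rfl
  simp only [ContinuousLinearMap.comp_apply, ContinuousLinearMap.coe_fst'] at h6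
  rw [h7] at h6
  exact h6

/-- The jet with coordinates `((t, x), y)`: it is represented by the section which in the chart `e`
is the straight line through `(t, x)` with velocity `(1, y)`. -/
theorem isFirstJet_of_coord {e : OpenPartialHomeomorph M (BaseModel n)} (he : IsFibredChart π e)
    {z : JetModel n} (hz : z.1 ∈ e.target) :
    IsFirstJet π ⟨e.symm z.1, mfderiv 𝓘(ℝ, BaseModel n) 𝓘(ℝ, BaseModel n) e.symm z.1
      ((NormedSpace.fromTangentSpace z.1).symm (1, z.2))⟩ := by
  let c : ℝ → BaseModel n := fun s => z.1 + (s - z.1.1) • ((1 : ℝ), z.2)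
  have hc : ContDiff ℝ ∞ c := by fun_prop
  have hct : c z.1.1 = z.1 := by simp [c]
  have hc1 : ∀ s, (c s).1 = s := by intro s; simp [c]
  have hcd : HasFDerivAt c ((ContinuousLinearMap.id ℝ ℝ).smulRight ((1 : ℝ), z.2)) z.1.1 := by
    have h1 : HasFDerivAt (fun s : ℝ => s - z.1.1) (ContinuousLinearMap.id ℝ ℝ) z.1.1 :=
      (hasFDerivAt_id _).sub_const _
    exact (h1.smul_const ((1 : ℝ), z.2)).const_add z.1
  have hz' : c z.1.1 ∈ e.target := by rw [hct]; exact hz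
  refine ⟨z.1.1, c ⁻¹' e.target, e.symm ∘ c, e.open_target.preimage hc.continuous, hz', ?_, ?_, ?_⟩
  · exact he.contMDiffOn_symm.comp hc.contMDiff.contMDiffOn fun s hs => hs
  · intro s hs
    rw [Function.comp_apply, ← he.2 _ (e.map_target hs), e.right_inv hs, hc1]
  · have hcm : MDifferentiableAt 𝓘(ℝ, ℝ) 𝓘(ℝ, BaseModel n) c z.1.1 :=
      hcd.differentiableAt.mdifferentiableAt
    have h1 := mfderiv_comp z.1.1 (he.mdifferentiable.mdifferentiableAt_symm hz') hcm
    rw [h1, mfderiv_eq_fderiv, hcd.fderiv]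
    have h2 : (⟨c z.1.1, ((1 : ℝ), z.2)⟩ : TangentBundle 𝓘(ℝ, BaseModel n) (BaseModel n))
        = ⟨z.1, ((1 : ℝ), z.2)⟩ := by rw [hct]
    have h3 := congrArg (tangentMap 𝓘(ℝ, BaseModel n) 𝓘(ℝ, BaseModel n) e.symm) h2
    refine h3.symm.trans ?_
    change (⟨e.symm (c z.1.1), _⟩ : TangentBundle 𝓘(ℝ, BaseModel n) M) = ⟨e.symm (c z.1.1), _⟩
    congr 1
    change _ = (mfderiv 𝓘(ℝ, BaseModel n) 𝓘(ℝ, BaseModel n) e.symm (c z.1.1))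
      ((1 : ℝ) • ((1 : ℝ), z.2))
    rw [one_smul]

theorem nonempty_jet (π : FibredOverReal n M) : Nonempty (Jet π) := by
  obtain ⟨p, -⟩ := π.surjective 0
  obtain ⟨e, he, hp⟩ := exists_isFibredChart π p
  exact ⟨⟨_, isFirstJet_of_coord (z := (e p, 0)) he (e.map_source hp)⟩⟩

/-- The coordinates `((t, x), y)` of a jet in a fibred chart `e`. -/
def jetCoord (e : OpenPartialHomeomorph M (BaseModel n)) (u : Jet π) : JetModel n :=
  (e u.base, (mvfderiv 𝓘(ℝ, BaseModel n) e u.base u.vel).2)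

open Classical in
/-- The jet with given coordinates `((t, x), y)` in a fibred chart `e`. -/
def jetOfCoord (e : OpenPartialHomeomorph M (BaseModel n)) (he : IsFibredChart π e)
    (z : JetModel n) : Jet π :=
  if hz : z.1 ∈ e.target then ⟨_, isFirstJet_of_coord he hz⟩
  else Classical.choice (nonempty_jet π)

theorem jetOfCoord_of_mem {e : OpenPartialHomeomorph M (BaseModel n)} (he : IsFibredChart π e)
    {z : JetModel n} (hz : z.1 ∈ e.target) :
    jetOfCoord e he z = ⟨_, isFirstJet_of_coord he hz⟩ := dif_pos hz

theorem jetOfCoord_base {e : OpenPartialHomeomorph M (BaseModel n)} (he : IsFibredChart π e)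
    {z : JetModel n} (hz : z.1 ∈ e.target) : (jetOfCoord e he z).base = e.symm z.1 := by
  rw [jetOfCoord_of_mem he hz]; rfl

theorem Jet.continuous_base : Continuous (Jet.base : Jet π → M) :=
  (FiberBundle.continuous_proj _ _).comp continuous_subtype_val

/-- The chart `((t, x), y)` of `J¹π` induced by a fibred chart `(t, x)` of `M`. -/
def jetChart (e : OpenPartialHomeomorph M (BaseModel n)) (he : IsFibredChart π e) :
    OpenPartialHomeomorph (Jet π) (JetModel n) where
  toFun := jetCoord e
  invFun := jetOfCoord e he
  source := Jet.base ⁻¹' e.source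
  target := Prod.fst ⁻¹' e.target
  map_source' u hu := e.map_source hu
  map_target' z hz := by
    rw [Set.mem_preimage, jetOfCoord_base he hz]
    exact e.map_target hz
  left_inv' u hu := by
    have hz : (jetCoord e u).1 ∈ e.target := e.map_source hu
    have h1 : ((1 : ℝ), (jetCoord e u).2) =
        mfderiv 𝓘(ℝ, BaseModel n) 𝓘(ℝ, BaseModel n) e u.base u.vel :=
      Prod.ext (Jet.vel_fst he u hu).symm rfl
    have h2 := congrArg (fun f => f u.vel) (he.mdifferentiable.symm_comp_deriv hu)
    have h3 : mfderiv 𝓘(ℝ, BaseModel n) 𝓘(ℝ, BaseModel n) e.symm (e u.base)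
        (mfderiv 𝓘(ℝ, BaseModel n) 𝓘(ℝ, BaseModel n) e u.base u.vel) = u.vel := h2
    rw [← h1] at h3
    refine (jetOfCoord_of_mem he hz).trans (Subtype.ext ?_)
    exact Bundle.TotalSpace.ext (e.left_inv hu) (heq_of_eq h3)
  right_inv' z hz := by
    have h1 := congrArg (fun f => f ((1 : ℝ), z.2)) (he.mdifferentiable.comp_symm_deriv hz)
    rw [jetOfCoord_of_mem he hz]
    exact Prod.ext (e.right_inv hz) (congrArg (fun w : BaseModel n => w.2) h1)
  open_source := e.open_source.preimage Jet.continuous_base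
  open_target := e.open_target.preimage continuous_fst
  continuousOn_toFun := by
    refine ContinuousOn.prodMk (e.continuousOn.comp Jet.continuous_base.continuousOn fun u hu => hu)
      ?_
    have h1 := he.contMDiffOn.continuousOn_tangentMapWithin (by simp) e.open_source.uniqueMDiffOn
    have h2 := (tangentBundleModelSpaceHomeomorph 𝓘(ℝ, BaseModel n)).continuous.comp_continuousOn h1
    have h3 : ContinuousOn (fun u : Jet π => ((tangentBundleModelSpaceHomeomorph 𝓘(ℝ, BaseModel n))
        (tangentMapWithin 𝓘(ℝ, BaseModel n) 𝓘(ℝ, BaseModel n) e e.source u.1)).2.2)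
        (Jet.base ⁻¹' e.source) :=
      continuous_snd.comp_continuousOn (continuous_snd.comp_continuousOn
        (h2.comp continuous_subtype_val.continuousOn fun u hu => hu))
    refine h3.congr fun u hu => ?_
    have h4 := mfderivWithin_of_isOpen (I := 𝓘(ℝ, BaseModel n)) (I' := 𝓘(ℝ, BaseModel n))
      (f := e) e.open_source hu
    exact (congrArg (fun f : BaseModel n →L[ℝ] BaseModel n => (f u.vel).2) h4).symm
  continuousOn_invFun := by
    have h1 := he.contMDiffOn_symm.continuousOn_tangentMapWithin (by simp)
      e.open_target.uniqueMDiffOn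
    have h2 : Continuous fun z : JetModel n =>
        (tangentBundleModelSpaceHomeomorph 𝓘(ℝ, BaseModel n)).symm (z.1, ((1 : ℝ), z.2)) := by
      refine (Homeomorph.continuous _).comp ?_
      exact continuous_fst.prodMk (continuous_const.prodMk continuous_snd)
    have h3 := h1.comp (h2.continuousOn (s := Prod.fst ⁻¹' e.target)) fun z hz => hz
    refine Topology.IsInducing.subtypeVal.continuousOn_iff.2 (h3.congr fun z hz => ?_)
    have h4 := mfderivWithin_of_isOpen (I := 𝓘(ℝ, BaseModel n)) (I' := 𝓘(ℝ, BaseModel n))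
      (f := e.symm) e.open_target hz
    refine (congrArg Subtype.val (jetOfCoord_of_mem he hz)).trans ?_
    exact Bundle.TotalSpace.ext rfl (heq_of_eq
      (congrArg (fun f : BaseModel n →L[ℝ] BaseModel n => f ((1 : ℝ), z.2)) h4).symm)

instance : ChartedSpace (JetModel n) (Jet π) where
  atlas := {φ | ∃ e, ∃ he : IsFibredChart π e, φ = jetChart e he}
  chartAt u := jetChart (exists_isFibredChart π (Jet.base u)).choose
    (exists_isFibredChart π u.base).choose_spec.1
  mem_chart_source u := (exists_isFibredChart π u.base).choose_spec.2
  chart_mem_atlas _ := ⟨_, _, rfl⟩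

/-- The first prolongation `(x, y) ↦ (g x, Dg x (1, y))` of a change of fibred coordinates. -/
def prolong (g : BaseModel n → BaseModel n) (z : JetModel n) : JetModel n :=
  (g z.1, (fderiv ℝ g z.1 (1, z.2)).2)

theorem contDiffOn_transition {e e' : OpenPartialHomeomorph M (BaseModel n)}
    (he : IsFibredChart π e) (he' : IsFibredChart π e') :
    ContDiffOn ℝ ∞ (e' ∘ e.symm) (e.target ∩ e.symm ⁻¹' e'.source) :=
  (he'.contMDiffOn.comp (he.contMDiffOn_symm.mono Set.inter_subset_left)
    fun _ hz => hz.2).contDiffOn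

theorem isOpen_transition (e e' : OpenPartialHomeomorph M (BaseModel n)) :
    IsOpen (e.target ∩ e.symm ⁻¹' e'.source) :=
  e.symm.isOpen_inter_preimage e'.open_source

theorem contDiffOn_prolong {g : BaseModel n → BaseModel n} {s : Set (BaseModel n)}
    (hs : IsOpen s) (hg : ContDiffOn ℝ ∞ g s) :
    ContDiffOn ℝ ∞ (prolong g) (Prod.fst ⁻¹' s) := by
  have h1 : ContDiffOn ℝ ∞ (fun z : JetModel n => g z.1) (Prod.fst ⁻¹' s) :=
    hg.comp contDiff_fst.contDiffOn fun z hz => hz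
  have h2 : ContDiffOn ℝ ∞ (fun z : JetModel n => fderiv ℝ g z.1) (Prod.fst ⁻¹' s) :=
    (hg.fderiv_of_isOpen hs (by simp)).comp contDiff_fst.contDiffOn fun z hz => hz
  exact h1.prodMk (contDiff_snd.comp_contDiffOn
    (h2.clm_apply (contDiff_const.prodMk contDiff_snd).contDiffOn))

theorem jetCoord_jetOfCoord {e e' : OpenPartialHomeomorph M (BaseModel n)}
    (he : IsFibredChart π e) (he' : IsFibredChart π e') {z : JetModel n}
    (hz : z.1 ∈ e.target ∩ e.symm ⁻¹' e'.source) :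
    jetCoord e' (jetOfCoord e he z) = prolong (e' ∘ e.symm) z := by
  rw [jetOfCoord_of_mem he hz.1]
  have h1 := mfderiv_comp z.1 (he'.mdifferentiable.mdifferentiableAt hz.2)
    (he.mdifferentiable.mdifferentiableAt_symm hz.1)
  rw [mfderiv_eq_fderiv] at h1
  refine Prod.ext rfl ?_
  exact (congrArg (fun f : BaseModel n →L[ℝ] BaseModel n => (f ((1 : ℝ), z.2)).2) h1).symm

instance : IsManifold 𝓘(ℝ, JetModel n) ∞ (Jet π) := by
  refine isManifold_of_contDiffOn _ _ _ ?_
  rintro _ _ ⟨e, he, rfl⟩ ⟨e', he', rfl⟩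
  have h1 := contDiffOn_prolong (isOpen_transition e e') (contDiffOn_transition he he')
  have h2 : ∀ z ∈ ((jetChart e he).symm.trans (jetChart e' he')).source,
      z.1 ∈ e.target ∩ e.symm ⁻¹' e'.source := by
    intro z hz
    have hz1 : z.1 ∈ e.target := hz.1
    refine ⟨hz1, ?_⟩
    have hz2 : (jetOfCoord e he z).base ∈ e'.source := hz.2
    rw [jetOfCoord_base he hz1] at hz2
    exact hz2
  exact (h1.mono fun z hz => h2 z hz.1).congr fun z hz =>
    jetCoord_jetOfCoord he he' (h2 z hz.1)

/-- The tensor `∂/∂yⁱ ⊗ δxⁱ`, `δxⁱ = dxⁱ - yⁱ dt`, at a point with fibre coordinates `y`. -/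
def modelJ (y : EuclideanSpace ℝ (Fin n)) : JetModel n →L[ℝ] JetModel n :=
  (ContinuousLinearMap.inr ℝ (BaseModel n) (EuclideanSpace ℝ (Fin n))).comp
    ((ContinuousLinearMap.snd ℝ ℝ (EuclideanSpace ℝ (Fin n)) -
      (ContinuousLinearMap.fst ℝ ℝ (EuclideanSpace ℝ (Fin n))).smulRight y).comp
        (ContinuousLinearMap.fst ℝ (BaseModel n) (EuclideanSpace ℝ (Fin n))))

variable (π) in
/-- The vertical endomorphism `J = ∂/∂yⁱ ⊗ δxⁱ`, written in the preferred induced chart at `u`;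
`vertEndo_eq` says that it has this expression in every induced chart. -/
def vertEndo : EndoField (JetModel n) (Jet π) := fun u =>
  (mvfderiv 𝓘(ℝ, JetModel n) (chartAt (JetModel n) u) u).inverse.comp
    ((modelJ (chartAt (JetModel n) u u).2).comp
      (mvfderiv 𝓘(ℝ, JetModel n) (chartAt (JetModel n) u) u))

theorem modelJ_apply (y : EuclideanSpace ℝ (Fin n)) (v : JetModel n) :
    modelJ y v = (0, v.1.2 - v.1.1 • y) := rfl

/-- `∂/∂yⁱ ⊗ δxⁱ` is invariant under prolonged changes of fibred coordinates. -/
theorem fderiv_prolong_modelJ {g : BaseModel n → BaseModel n} {s : Set (BaseModel n)}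
    (hs : IsOpen s) (hg : ContDiffOn ℝ ∞ g s) (hg1 : ∀ x ∈ s, (g x).1 = x.1) {z : JetModel n}
    (hz : z.1 ∈ s) :
    (fderiv ℝ (prolong g) z).comp (modelJ z.2) =
      (modelJ (prolong g z).2).comp (fderiv ℝ (prolong g) z) := by
  have hgd : HasFDerivAt g (fderiv ℝ g z.1) z.1 :=
    ((hg.contDiffAt (hs.mem_nhds hz)).differentiableAt (by simp)).hasFDerivAt
  have hgd2 : HasFDerivAt (fderiv ℝ g) (fderiv ℝ (fderiv ℝ g) z.1) z.1 :=
    (((hg.fderiv_of_isOpen hs (m := ∞) (by simp)).contDiffAt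
      (hs.mem_nhds hz)).differentiableAt (by simp)).hasFDerivAt
  have hfst : ∀ v, (fderiv ℝ g z.1 v).1 = v.1 := by
    intro v
    have h1 : HasFDerivAt (fun x => (g x).1)
        ((ContinuousLinearMap.fst ℝ ℝ _).comp (fderiv ℝ g z.1)) z.1 := hasFDerivAt_fst.comp z.1 hgd
    have h2 : (fun x => (g x).1) =ᶠ[𝓝 z.1] fun x => x.1 := by
      filter_upwards [hs.mem_nhds hz] with x hx using hg1 x hx
    have h3 := (h1.congr_of_eventuallyEq h2.symm).unique hasFDerivAt_fst
    exact congrArg (fun f : BaseModel n →L[ℝ] ℝ => f v) h3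
  have hp : HasFDerivAt (prolong g)
      (((fderiv ℝ g z.1).comp (ContinuousLinearMap.fst ℝ _ _)).prod
        ((ContinuousLinearMap.snd ℝ _ _).comp
          ((fderiv ℝ g z.1).comp ((0 : JetModel n →L[ℝ] ℝ).prod (ContinuousLinearMap.snd ℝ _ _)) +
            ((fderiv ℝ (fderiv ℝ g) z.1).comp (ContinuousLinearMap.fst ℝ _ _)).flip
              (1, z.2)))) z := by
    have h1 : HasFDerivAt (fun w : JetModel n => g w.1) _ z := hgd.comp z hasFDerivAt_fst
    have h2 : HasFDerivAt (fun w : JetModel n => fderiv ℝ g w.1) _ z :=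
      hgd2.comp z hasFDerivAt_fst
    have h0 : HasFDerivAt (fun w : JetModel n => w.2) (ContinuousLinearMap.snd ℝ _ _) z :=
      hasFDerivAt_snd
    have h3 : HasFDerivAt (fun w : JetModel n => ((1 : ℝ), w.2)) _ z :=
      (hasFDerivAt_const (1 : ℝ) z).prodMk h0
    exact h1.prodMk (hasFDerivAt_snd.comp z (h2.clm_apply h3))
  rw [hp.fderiv]
  refine ContinuousLinearMap.ext fun v => ?_
  have hsplit : fderiv ℝ g z.1 (0, v.1.2 - v.1.1 • z.2)
      = fderiv ℝ g z.1 v.1 - v.1.1 • fderiv ℝ g z.1 (1, z.2) := by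
    rw [← map_smul, ← map_sub]
    congr 1
    exact Prod.ext (by simp) (by simp)
  simp only [ContinuousLinearMap.comp_apply, modelJ_apply, ContinuousLinearMap.prod_apply,
    _root_.add_apply, ContinuousLinearMap.flip_apply, ContinuousLinearMap.coe_fst',
    ContinuousLinearMap.coe_snd', _root_.zero_apply, map_zero, add_zero, hsplit,
    hfst, prolong]
  rfl

theorem vertEndo_eq {e : OpenPartialHomeomorph M (BaseModel n)} (he : IsFibredChart π e)
    (u : Jet π) (hu : u.base ∈ e.source) :
    (mvfderiv 𝓘(ℝ, JetModel n) (jetChart e he) u).comp (vertEndo π u) =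
      (modelJ (jetCoord e u).2).comp (mvfderiv 𝓘(ℝ, JetModel n) (jetChart e he) u) := by
  obtain ⟨e₀, he₀, hφ⟩ : ∃ e₀, ∃ he₀ : IsFibredChart π e₀,
    chartAt (JetModel n) u = jetChart e₀ he₀ := ⟨_, _, rfl⟩
  have hu₀ : u ∈ (jetChart e₀ he₀).source := hφ ▸ mem_chart_source (JetModel n) u
  have hu₀' : u.base ∈ e₀.source := hu₀
  have hmd := mdifferentiable_chart (I := 𝓘(ℝ, JetModel n)) u
  rw [hφ] at hmd
  have hinv : (mvfderiv 𝓘(ℝ, JetModel n) (jetChart e₀ he₀) u).IsInvertible :=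
    ⟨hmd.mfderiv hu₀, rfl⟩
  have hs := isOpen_transition e₀ e
  have hg := contDiffOn_transition he₀ he
  have hz : (jetChart e₀ he₀ u).1 ∈ e₀.target ∩ e₀.symm ⁻¹' e.source := by
    refine ⟨e₀.map_source hu₀', ?_⟩
    change e₀.symm (e₀ u.base) ∈ e.source
    rwa [e₀.left_inv hu₀']
  have hloc : (jetChart e he : Jet π → JetModel n) =ᶠ[𝓝 u]
      prolong (e ∘ e₀.symm) ∘ jetChart e₀ he₀ := by
    filter_upwards [(jetChart e₀ he₀).open_source.mem_nhds hu₀,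
      (jetChart e he).open_source.mem_nhds hu] with w hw hw'
    have hwz : (jetChart e₀ he₀ w).1 ∈ e₀.target ∩ e₀.symm ⁻¹' e.source := by
      refine ⟨e₀.map_source hw, ?_⟩
      change e₀.symm (e₀ w.base) ∈ e.source
      rw [e₀.left_inv hw]; exact hw'
    refine Eq.trans ?_ (jetCoord_jetOfCoord he₀ he hwz)
    exact congrArg (jetCoord e) ((jetChart e₀ he₀).left_inv hw).symm
  have hd : DifferentiableAt ℝ (prolong (e ∘ e₀.symm)) (jetChart e₀ he₀ u) :=
    ((contDiffOn_prolong hs hg).contDiffAt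
      ((hs.preimage continuous_fst).mem_nhds hz)).differentiableAt (by simp)
  have hcomp : mvfderiv 𝓘(ℝ, JetModel n) (jetChart e he) u =
      (fderiv ℝ (prolong (e ∘ e₀.symm)) (jetChart e₀ he₀ u)).comp
        (mvfderiv 𝓘(ℝ, JetModel n) (jetChart e₀ he₀) u) := by
    have h1 := hloc.mfderiv_eq (I := 𝓘(ℝ, JetModel n)) (I' := 𝓘(ℝ, JetModel n))
    have h2 := mfderiv_comp u hd.mdifferentiableAt (hmd.mdifferentiableAt hu₀)
    rw [mfderiv_eq_fderiv] at h2
    exact h1.trans h2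
  have hval : jetCoord e u = prolong (e ∘ e₀.symm) (jetChart e₀ he₀ u) := hloc.self_of_nhds
  have hJ : vertEndo π u = (mvfderiv 𝓘(ℝ, JetModel n) (jetChart e₀ he₀) u).inverse.comp
      ((modelJ (jetChart e₀ he₀ u).2).comp
        (mvfderiv 𝓘(ℝ, JetModel n) (jetChart e₀ he₀) u)) := by
    rw [vertEndo, hφ]
  have hcore := fderiv_prolong_modelJ hs hg (fun x hx => by
    rw [Function.comp_apply, he.2 _ hx.2, ← he₀.2 _ (e₀.map_target hx.1), e₀.right_inv hx.1]) hz
  rw [hval, hJ, hcomp]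
  ext1 v
  have hself : ∀ w, mvfderiv 𝓘(ℝ, JetModel n) (jetChart e₀ he₀) u
      ((mvfderiv 𝓘(ℝ, JetModel n) (jetChart e₀ he₀) u).inverse w) = w := fun w =>
    hinv.self_apply_inverse w
  have := congrArg (fun f : JetModel n →L[ℝ] JetModel n =>
    f (mvfderiv 𝓘(ℝ, JetModel n) (jetChart e₀ he₀) u v)) hcore
  simp only [ContinuousLinearMap.comp_apply] at this ⊢
  rw [hself, this]

variable (π) in
/-- The `1`-form `dt` on `J¹π`, the differential of the global function `t = π ∘ π₁₀`. -/
def dt : CovectorField (JetModel n) (Jet π) := fun u =>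
  mvfderiv 𝓘(ℝ, JetModel n) (fun w : Jet π => π.proj w.base) u

/-- A form on `J¹π` is semi-basic if it vanishes whenever one of its arguments is vertical, i.e. is
in the kernel of the differential of `π₁₀`. -/
def IsSemiBasic {k : ℕ} (θ : FormField (JetModel n) (Jet π) k) : Prop :=
  ∀ (u : Jet π) (X : Fin k → TangentSpace 𝓘(ℝ, JetModel n) u) (i : Fin k),
    mfderiv 𝓘(ℝ, JetModel n) 𝓘(ℝ, BaseModel n) Jet.base u (X i) = 0 → θ u X = 0

end Jets

end JetForms

end

/-
A wedge product with `dt` only sees the kernel of `dt`, and there the vertical endomorphism `J` of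
an induced chart agrees with the constant endomorphism `A = ∂/∂yⁱ ⊗ dxⁱ`. Modulo `dt`, `d_J` is
therefore the operator `d_A` that differentiates along `A v` instead of `v`. Symmetry of second
derivatives gives `d_A ∘ d_A = 0`, hence (i). For (ii), replace a semi-basic `θ` by its part
without `dt`, a form in the `dxⁱ` alone. With `S = ∂/∂xⁱ ⊗ dyⁱ`, contraction with the vector field
`z ↦ S z` satisfies a Cartan formula for `d_A`, in which the Lie derivative is differentiation
along the Liouville field `A S z = yⁱ ∂/∂yⁱ` plus multiplication by the degree. Integrating along
the fibrewise scaling `(t, x, y) ↦ (t, x, s y)`, under which the chart domains are star-shaped,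
inverts `d_A`.
-/

noncomputable section

set_option maxSynthPendingDepth 3

namespace JetForms

/-! ### Forms modulo a linear form -/

section EqOnKer

variable {T : Type*} [AddCommGroup T] [Module ℝ T] [TopologicalSpace T] {k : ℕ}

/-- Congruence of alternating forms modulo the linear form `α`, expressed by equality on the
kernel of `α`. -/
def EqOnKer (α : T →L[ℝ] ℝ) (η η' : T [⋀^Fin k]→L[ℝ] ℝ) : Prop :=
  ∀ v, (∀ i, α (v i) = 0) → η v = η' v

theorem EqOnKer.symm {α : T →L[ℝ] ℝ} {η η' : T [⋀^Fin k]→L[ℝ] ℝ} (h : EqOnKer α η η') :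
    EqOnKer α η' η := fun v hv => (h v hv).symm

theorem EqOnKer.trans {α : T →L[ℝ] ℝ} {η η' η'' : T [⋀^Fin k]→L[ℝ] ℝ} (h : EqOnKer α η η')
    (h' : EqOnKer α η' η'') : EqOnKer α η η'' := fun v hv => (h v hv).trans (h' v hv)

theorem eqOnKer_compContinuousLinearMap_iff {T' : Type*} [AddCommGroup T'] [Module ℝ T']
    [TopologicalSpace T'] {L : T' →L[ℝ] T} (hL : Function.Surjective L) {α : T →L[ℝ] ℝ}
    {η η' : T [⋀^Fin k]→L[ℝ] ℝ} :
    EqOnKer (α.comp L) (η.compContinuousLinearMap L) (η'.compContinuousLinearMap L) ↔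
      EqOnKer α η η' := by
  refine ⟨fun h v hv => ?_, fun h v hv => h _ hv⟩
  obtain ⟨w, rfl⟩ := hL.comp_left v
  exact h w hv

theorem map_eq_map_of_forall_sub {B : T [⋀^Fin k]→L[ℝ] ℝ} {v w : Fin k → T}
    (h : ∀ (i : Fin k) (x : Fin k → T), x i = v i - w i →
      (∀ j ≠ i, x j = v j ∨ x j = w j) → B x = 0) : B v = B w := by
  have hsum := B.toMultilinearMap.map_sub_map_piecewise v w Finset.univ
  rw [Finset.piecewise_univ, Finset.sum_eq_zero] at hsum
  · exact sub_eq_zero.1 hsum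
  · refine fun i _ => h i _ (by simp) fun j hj => ?_
    by_cases hji : j < i <;> simp [hji, Ne.symm hj]

theorem map_sub_smul_eq_map {B : T [⋀^Fin k]→L[ℝ] ℝ} {v : Fin k → T} {i : Fin k}
    {c : Fin k → ℝ} (hc : c i = 0) : B (fun j => v j - c j • v i) = B v := by
  refine map_eq_map_of_forall_sub fun j x hxj hx => ?_
  have hx' : x = Function.update x j (-c j • v i) := by
    rw [eq_comm, Function.update_eq_self_iff, hxj, neg_smul]
    abel
  rw [hx', B.map_update_smul]
  by_cases hj : j = i
  · simp [hj, hc]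
  · have hxi : x i = v i := by simpa [hc] using hx i (Ne.symm hj)
    rw [B.map_eq_zero_of_eq _ (by simp [hxi, Ne.symm hj]) hj, smul_zero]

theorem map_eq_of_forall_sub_mem {B : T [⋀^Fin k]→L[ℝ] ℝ} {K : Submodule ℝ T}
    (hB : ∀ v i, v i ∈ K → B v = 0) {v w : Fin k → T} (h : ∀ i, v i - w i ∈ K) : B v = B w :=
  map_eq_map_of_forall_sub fun i x hx _ => hB x i (hx ▸ h i)

theorem EqOnKer.wedgeOne_eq {α : T →L[ℝ] ℝ} {η η' : T [⋀^Fin k]→L[ℝ] ℝ} (h : EqOnKer α η η') :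
    wedgeOne η α = wedgeOne η' α := by
  ext v
  by_cases hv : ∃ i, α (v i) ≠ 0
  · obtain ⟨i, hi⟩ := hv
    set c : Fin (k + 1) → ℝ := Function.update (fun j => α (v j) / α (v i)) i 0
    have hci : c i = 0 := Function.update_self ..
    have hker : ∀ j ≠ i, α (v j - c j • v i) = 0 := fun j hj => by simp [c, hj, hi]
    rw [← map_sub_smul_eq_map hci, ← map_sub_smul_eq_map (v := v) hci,
      wedgeOne_apply, wedgeOne_apply]
    congr! 3 with j
    by_cases hj : j = i
    · rw [hj, h]
      exact fun l => hker _ (Fin.succAbove_ne i l)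
    · simp [hker j hj]
  · push Not at hv
    simp [wedgeOne_apply, hv]

theorem wedgeOne_eq_wedgeOne_iff {α : T →L[ℝ] ℝ} (hα : α ≠ 0) {η η' : T [⋀^Fin k]→L[ℝ] ℝ} :
    wedgeOne η α = wedgeOne η' α ↔ EqOnKer α η η' := by
  refine ⟨fun h v hv => ?_, EqOnKer.wedgeOne_eq⟩
  obtain ⟨e, he⟩ : ∃ e, α e ≠ 0 := by simpa [DFunLike.ext_iff] using hα
  have wedge_cons (B : T [⋀^Fin k]→L[ℝ] ℝ) :
      wedgeOne B α (Fin.cons e v) = (-1) ^ k * (α e * B v) := by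
    simp [wedgeOne_apply, Fin.sum_univ_succ, hv]
  simpa [wedge_cons, he] using congrArg (· (Fin.cons e v)) h

theorem wedgeOne_zero (α : T →L[ℝ] ℝ) : wedgeOne (0 : T [⋀^Fin k]→L[ℝ] ℝ) α = 0 := by
  ext v
  simp [wedgeOne_apply]

theorem insertEndo_compContinuousLinearMap {T' : Type*} [AddCommGroup T'] [Module ℝ T']
    [TopologicalSpace T'] {A : T →L[ℝ] T} {A' : T' →L[ℝ] T'} {L : T' →L[ℝ] T}
    (h : L.comp A' = A.comp L) (η : T [⋀^Fin k]→L[ℝ] ℝ) :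
    insertEndo A' (η.compContinuousLinearMap L) = (insertEndo A η).compContinuousLinearMap L := by
  ext v
  have hL (x : T') : L (A' x) = A (L x) := congrArg (· x) h
  simp [insertEndo_apply, Function.comp_update, hL]

end EqOnKer

/-! ### Parametric integrals and smoothness of forms -/

section ParametricIntegral

theorem intervalIntegrable_slice {E G : Type*} [TopologicalSpace E] [NormedAddCommGroup G]
    {Ω : Set (E × ℝ)} {f : E × ℝ → G} {a b : ℝ} (hf : ContinuousOn f Ω) {x : E}
    (hx : ∀ s ∈ Set.uIcc a b, (x, s) ∈ Ω) :
    IntervalIntegrable (fun s => f (x, s)) MeasureTheory.volume a b :=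
  (hf.comp (Continuous.prodMk_right x).continuousOn hx).intervalIntegrable

variable {E G : Type*} [NormedAddCommGroup E] [NormedSpace ℝ E] [FiniteDimensional ℝ E]
  [NormedAddCommGroup G] [NormedSpace ℝ G] {Ω : Set (E × ℝ)} {f : E × ℝ → G} {a b : ℝ}

theorem hasFDerivAt_intervalIntegral_of_contDiffOn (hΩ : IsOpen Ω) (hf : ContDiffOn ℝ 1 f Ω)
    {x : E} (hx : ∀ s ∈ Set.uIcc a b, (x, s) ∈ Ω) :
    HasFDerivAt (fun y => ∫ s in a..b, f (y, s))
      (∫ s in a..b, (fderiv ℝ f (x, s)).comp (ContinuousLinearMap.inl ℝ E ℝ)) x := by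
  let f' : E × ℝ → E →L[ℝ] G := fun p => (fderiv ℝ f p).comp (ContinuousLinearMap.inl ℝ E ℝ)
  have hf' : ContinuousOn f' Ω :=
    (hf.continuousOn_fderiv_of_isOpen hΩ le_rfl).clm_comp continuousOn_const
  obtain ⟨u, v, hu, -, hxu, hv, huv⟩ := generalized_tube_lemma (isCompact_singleton (x := x))
    (isCompact_uIcc (a := a) (b := b)) hΩ (by rintro ⟨y, s⟩ ⟨rfl, hs⟩; exact hx s hs)
  obtain ⟨r, hr, hru⟩ := Metric.nhds_basis_closedBall.mem_iff.1 (hu.mem_nhds (hxu rfl))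
  have hball : Metric.closedBall x r ×ˢ Set.uIcc a b ⊆ Ω := (Set.prod_mono hru hv).trans huv
  obtain ⟨C, hC⟩ := ((isCompact_closedBall x r).prod isCompact_uIcc).exists_bound_of_continuousOn
    (hf'.mono hball)
  have hslice {y : E} (hy : y ∈ Metric.closedBall x r) : ∀ s ∈ Set.uIcc a b, (y, s) ∈ Ω :=
    fun s hs => hball ⟨hy, hs⟩
  refine intervalIntegral.hasFDerivAt_integral_of_dominated_of_fderiv_le
    (F' := fun y s => f' (y, s)) (bound := fun _ => C) (Metric.closedBall_mem_nhds x hr)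
    ?_ (intervalIntegrable_slice hf.continuousOn hx)
    (intervalIntegrable_slice hf' hx).aestronglyMeasurable_restrict_uIoc ?_
    intervalIntegrable_const ?_
  · filter_upwards [Metric.closedBall_mem_nhds x hr] with y hy
    exact (intervalIntegrable_slice hf.continuousOn (hslice hy)).aestronglyMeasurable_restrict_uIoc
  · exact .of_forall fun s hs y hy => hC (y, s) ⟨hy, Set.uIoc_subset_uIcc hs⟩
  · refine .of_forall fun s hs y hy => ?_
    have hys := hΩ.mem_nhds (hslice hy s (Set.uIoc_subset_uIcc hs))
    exact ((hf.contDiffAt hys).differentiableAt one_ne_zero).hasFDerivAt.comp y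
      (hasFDerivAt_prodMk_left y s)

theorem fderiv_intervalIntegral_apply (hΩ : IsOpen Ω) (hf : ContDiffOn ℝ 1 f Ω)
    {x : E} (hx : ∀ s ∈ Set.uIcc a b, (x, s) ∈ Ω) (w : E) :
    fderiv ℝ (fun y => ∫ s in a..b, f (y, s)) x w = ∫ s in a..b, fderiv ℝ f (x, s) (w, 0) := by
  have hf' : ContinuousOn (fun p => (fderiv ℝ f p).comp (ContinuousLinearMap.inl ℝ E ℝ)) Ω :=
    (hf.continuousOn_fderiv_of_isOpen hΩ le_rfl).clm_comp continuousOn_const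
  rw [(hasFDerivAt_intervalIntegral_of_contDiffOn hΩ hf hx).fderiv,
    ContinuousLinearMap.intervalIntegral_apply (intervalIntegrable_slice hf' hx)]
  simp

theorem contDiffOn_intervalIntegral {U : Set E} (hU : IsOpen U) (hΩ : IsOpen Ω)
    (hUΩ : U ×ˢ Set.uIcc a b ⊆ Ω) (hf : ContDiffOn ℝ ∞ f Ω) :
    ContDiffOn ℝ ∞ (fun y => ∫ s in a..b, f (y, s)) U := by
  have hslice {y : E} (hy : y ∈ U) : ∀ s ∈ Set.uIcc a b, (y, s) ∈ Ω := fun s hs => hUΩ ⟨hy, hs⟩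
  refine contDiffOn_infty.2 fun m => ?_
  induction m generalizing f with
  | zero =>
    refine contDiffOn_zero.2 fun x hx => ContinuousAt.continuousWithinAt ?_
    exact (hasFDerivAt_intervalIntegral_of_contDiffOn hΩ (hf.of_le (by simp))
      (hslice hx)).continuousAt
  | succ m ih =>
    have hf1 : ContDiffOn ℝ 1 f Ω := hf.of_le (by simp)
    push_cast
    refine (contDiffOn_succ_iff_fderiv_of_isOpen hU).2 ⟨fun x hx => ?_, by simp, ?_⟩
    · exact (hasFDerivAt_intervalIntegral_of_contDiffOn hΩ hf1
        (hslice hx)).differentiableAt.differentiableWithinAt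
    · refine contDiffOn_clm_apply.2 fun w => ?_
      have hf' : ContDiffOn ℝ ∞ (fun p => fderiv ℝ f p (w, 0)) Ω :=
        (hf.fderiv_of_isOpen hΩ (by simp)).clm_apply contDiffOn_const
      exact (ih hf').congr fun x hx => fderiv_intervalIntegral_apply hΩ hf1 (hslice hx) w

end ParametricIntegral

section Smooth

variable {V : Type*} [NormedAddCommGroup V] [NormedSpace ℝ V]
  {E : Type*} [NormedAddCommGroup E] [NormedSpace ℝ E] {k : ℕ} {s : Set E} {m : WithTop ℕ∞}

theorem contDiffOn_alternating_apply {f : E → V [⋀^Fin k]→L[ℝ] ℝ} {w : E → Fin k → V}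
    (hf : ContDiffOn ℝ m f s) (hw : ∀ i, ContDiffOn ℝ m (fun x => w x i) s) :
    ContDiffOn ℝ m (fun x => f x (w x)) s := by
  let F := ContinuousAlternatingMap.toContinuousMultilinearMapCLM
    (𝕜 := ℝ) (E := V) (F := ℝ) (ι := Fin k) ℝ
  have heval : ContDiff ℝ m (fun p : (V [⋀^Fin k]→L[ℝ] ℝ) × (Fin k → V) => F p.1 p.2) :=
    contDiffOn_univ.1 <| F.analyticOnNhd_uncurry_of_multilinear.contDiffOn uniqueDiffOn_univ
  exact heval.comp_contDiffOn (hf.prodMk (contDiffOn_pi.2 hw))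

variable [FiniteDimensional ℝ V]

theorem contDiffOn_alternating_iff_apply {f : E → V [⋀^Fin k]→L[ℝ] ℝ} :
    ContDiffOn ℝ m f s ↔ ∀ v, ContDiffOn ℝ m (fun x => f x v) s := by
  refine ⟨fun h v => contDiffOn_alternating_apply h fun _ => contDiffOn_const, fun h => ?_⟩
  let b := Module.finBasis ℝ V
  let coeff : (V [⋀^Fin k]→L[ℝ] ℝ) →ₗ[ℝ] ((Fin k → Fin (Module.finrank ℝ V)) → ℝ) :=
    { toFun := fun B σ => B fun i => b (σ i)
      map_add' := fun _ _ => rfl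
      map_smul' := fun _ _ => rfl }
  have hcoeff : Function.Injective coeff := fun B B' h =>
    ContinuousAlternatingMap.toContinuousMultilinearMap_injective <|
      ContinuousMultilinearMap.toMultilinearMap_injective <|
        Module.Basis.ext_multilinear (fun _ => b) fun σ => congrFun h σ
  obtain ⟨g, hg⟩ := coeff.exists_leftInverse_of_injective (LinearMap.ker_eq_bot.2 hcoeff)
  have hgf : ContDiffOn ℝ m (fun x => g (coeff (f x))) s :=
    g.toContinuousLinearMap.contDiff.comp_contDiffOn (contDiffOn_pi.2 fun σ => h _)
  exact hgf.congr fun x _ => (DFunLike.congr_fun hg (f x)).symm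

theorem contDiffOn_alternating_comp {f : E → V [⋀^Fin k]→L[ℝ] ℝ} {L : E → V →L[ℝ] V}
    (hf : ContDiffOn ℝ m f s) (hL : ContDiffOn ℝ m L s) :
    ContDiffOn ℝ m (fun x => (f x).compContinuousLinearMap (L x)) s :=
  contDiffOn_alternating_iff_apply.2 fun v =>
    contDiffOn_alternating_apply (w := fun x i => L x (v i)) hf fun _ =>
      hL.clm_apply contDiffOn_const

theorem contDiffOn_insertEndo {f : E → V [⋀^Fin k]→L[ℝ] ℝ} {L : E → V →L[ℝ] V}
    (hf : ContDiffOn ℝ m f s) (hL : ContDiffOn ℝ m L s) :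
    ContDiffOn ℝ m (fun x => insertEndo (L x) (f x)) s := by
  refine contDiffOn_alternating_iff_apply.2 fun v => ?_
  simp only [insertEndo_apply]
  refine ContDiffOn.sum fun i _ => contDiffOn_alternating_apply hf fun j => ?_
  obtain rfl | hj := eq_or_ne j i
  · simpa using hL.clm_apply contDiffOn_const
  · simpa [hj] using contDiffOn_const

end Smooth

/-! ### The Poincaré lemma for a constant endomorphism -/

section Along

open ContinuousAlternatingMap

variable {V : Type*} [NormedAddCommGroup V] [NormedSpace ℝ V] {k : ℕ} {A : V →L[ℝ] V}
  {α : V →L[ℝ] ℝ} {β β' : V → V [⋀^Fin k]→L[ℝ] ℝ} {x : V}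

variable (k A) in
/-- The linear map that takes the derivative of a form at a point to the value of `d_A` there:
precomposition with `A`, followed by alternatization. -/
def alternatizeAlong : (V →L[ℝ] V [⋀^Fin k]→L[ℝ] ℝ) →L[ℝ] V [⋀^Fin (k + 1)]→L[ℝ] ℝ :=
  (alternatizeUncurryFinCLM ℝ V ℝ).comp (ContinuousLinearMap.precomp _ A)

/-- The derivation `d_A` on the forms of a normed space, for a constant endomorphism `A`: the
exterior derivative with directional derivatives along `A v` in place of `v`. -/
def extDerivAlong (A : V →L[ℝ] V) (β : V → V [⋀^Fin k]→L[ℝ] ℝ) (x : V) :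
    V [⋀^Fin (k + 1)]→L[ℝ] ℝ :=
  alternatizeAlong k A (fderiv ℝ β x)

theorem extDerivAlong_apply (A : V →L[ℝ] V) (β : V → V [⋀^Fin k]→L[ℝ] ℝ) (x : V)
    (v : Fin (k + 1) → V) :
    extDerivAlong A β x v =
      ∑ i : Fin (k + 1), (-1 : ℤ) ^ (i : ℕ) • fderiv ℝ β x (A (v i)) (i.removeNth v) := by
  simp [extDerivAlong, alternatizeAlong, alternatizeUncurryFin_apply]

theorem EqOnKer.extDerivAlong (h : DifferentiableAt ℝ β x) (h' : DifferentiableAt ℝ β' x)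
    (heq : ∀ᶠ z in 𝓝 x, EqOnKer α (β z) (β' z)) :
    EqOnKer α (extDerivAlong A β x) (extDerivAlong A β' x) := by
  intro v hv
  rw [extDerivAlong_apply, extDerivAlong_apply]
  refine Finset.sum_congr rfl fun i _ => ?_
  have hv' : ∀ j, α (i.removeNth v j) = 0 := fun j => hv _
  have hβ := Filter.EventuallyEq.fderiv_eq (𝕜 := ℝ) (heq.mono fun z hz => hz _ hv')
  rw [← fderiv_continuousAlternatingMap_apply_const_apply h, hβ,
    fderiv_continuousAlternatingMap_apply_const_apply h']

theorem extDerivAlong_comp (h : DifferentiableAt ℝ β x) {p : V →L[ℝ] V} (hp : A.comp p = A) :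
    extDerivAlong A (fun z => (β z).compContinuousLinearMap p) x =
      (extDerivAlong A β x).compContinuousLinearMap p := by
  ext v
  have hA (w : V) : A (p w) = A w := congrArg (· w) hp
  let pullback : (V [⋀^Fin k]→L[ℝ] ℝ) →L[ℝ] V [⋀^Fin k]→L[ℝ] ℝ := compContinuousLinearMapCLM p
  have hβ : fderiv ℝ (fun z => (β z).compContinuousLinearMap p) x =
      pullback.comp (fderiv ℝ β x) := (pullback.hasFDerivAt.comp x h.hasFDerivAt).fderiv
  simp only [extDerivAlong_apply, hβ, compContinuousLinearMap_apply]
  refine Finset.sum_congr rfl fun i _ => ?_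
  simp only [Function.comp_apply, hA]
  rfl

theorem hasFDerivAt_extDerivAlong (h : ContDiffAt ℝ 2 β x) :
    HasFDerivAt (extDerivAlong A β) ((alternatizeAlong k A).comp (fderiv ℝ (fderiv ℝ β) x)) x := by
  have hd : DifferentiableAt ℝ (fderiv ℝ β) x :=
    (h.fderiv_right (m := 1) (by norm_num)).differentiableAt (by simp)
  exact (alternatizeAlong k A).hasFDerivAt.comp x hd.hasFDerivAt

theorem extDerivAlong_extDerivAlong (h : ContDiffAt ℝ 2 β x) :
    extDerivAlong A (extDerivAlong A β) x = 0 := by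
  have hsymm : IsSymmSndFDerivAt ℝ β x := h.isSymmSndFDerivAt (by simp)
  rw [extDerivAlong, (hasFDerivAt_extDerivAlong h).fderiv]
  exact alternatizeUncurryFin_alternatizeUncurryFinCLM_comp_of_symmetric
    (f := ((ContinuousLinearMap.precomp _ A).comp (fderiv ℝ (fderiv ℝ β) x)).comp A)
    fun v w => hsymm.eq (A v) (A w)

theorem differentiableAt_extDerivAlong (h : ContDiffAt ℝ 2 β x) :
    DifferentiableAt ℝ (extDerivAlong A β) x :=
  (hasFDerivAt_extDerivAlong h).differentiableAt

theorem fderiv_insertEndo_apply {J : V → V →L[ℝ] V} (hJ : ∀ z v, α v = 0 → J z v = A v)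
    (h : DifferentiableAt ℝ β x) (w : V) {v : Fin k → V} (hv : ∀ i, α (v i) = 0) :
    fderiv ℝ (fun z => insertEndo (J z) (β z) v) x w = insertEndo (J x) (fderiv ℝ β x w) v := by
  have heq : (fun z => insertEndo (J z) (β z) v) =
      fun z => ∑ l, β z (Function.update v l (A (v l))) := by
    ext z
    simp only [insertEndo_apply, hJ z _ (hv _)]
  rw [heq, fderiv_fun_sum fun l _ => h.continuousAlternatingMap_apply_const _]
  simp [insertEndo_apply, hJ x _ (hv _), fderiv_continuousAlternatingMap_apply_const_apply h]

theorem eqOnKer_extDerivAlong {J : V → V →L[ℝ] V} (hJ : ∀ z v, α v = 0 → J z v = A v)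
    (h : DifferentiableAt ℝ β x) (h' : DifferentiableAt ℝ (fun z => insertEndo (J z) (β z)) x) :
    EqOnKer α
      (insertEndo (J x) (extDeriv β x) - extDeriv (fun z => insertEndo (J z) (β z)) x)
      (extDerivAlong A β x) := by
  intro v hv
  have hv' (i : Fin (k + 1)) (j : Fin k) : α (i.removeNth v j) = 0 := hv _
  rw [ContinuousAlternatingMap.sub_apply, extDeriv_apply h', extDerivAlong_apply, insertEndo_apply]
  simp only [fderiv_insertEndo_apply hJ h _ (hv' _), extDeriv_apply h,
    fderiv_continuousAlternatingMap_apply_const_apply h, hJ x _ (hv _)]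
  simp only [insertEndo_apply, hJ x _ (hv' _ _)]
  rw [Finset.sum_comm, ← Finset.sum_sub_distrib]
  refine Finset.sum_congr rfl fun i _ => ?_
  rw [Fin.sum_univ_succAbove _ i, Function.update_self, Fin.removeNth_update, add_sub_assoc,
    add_eq_left, sub_eq_zero, Finset.smul_sum]
  refine Finset.sum_congr rfl fun l _ => ?_
  rw [Fin.removeNth_update_succAbove, Function.update_of_ne (Fin.succAbove_ne i l).symm]
  rfl

end Along

section Homotopy

open ContinuousAlternatingMap

variable {V : Type*} [NormedAddCommGroup V] [NormedSpace ℝ V] {m : ℕ} {A S : V →L[ℝ] V} {x : V}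

theorem extDerivAlong_comp_clm {k : ℕ} {β : V → V [⋀^Fin k]→L[ℝ] ℝ} {σ : V →L[ℝ] V} {s : ℝ}
    (hσ : σ.comp A = s • A) (h : DifferentiableAt ℝ β (σ x)) :
    extDerivAlong A (fun z => β (σ z)) x = s • extDerivAlong A β (σ x) := by
  have hβ : fderiv ℝ (fun z => β (σ z)) x = (fderiv ℝ β (σ x)).comp σ :=
    (h.hasFDerivAt.comp x σ.hasFDerivAt).fderiv
  rw [extDerivAlong, extDerivAlong, hβ, ← map_smul]
  ext v
  simp [alternatizeAlong, ContinuousLinearMap.comp_assoc, hσ]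

theorem extDerivAlong_const_smul {k : ℕ} (c : ℝ) (β : V → V [⋀^Fin k]→L[ℝ] ℝ) :
    extDerivAlong A (c • β) x = c • extDerivAlong A β x := by
  rw [extDerivAlong, fderiv_const_smul_field, Pi.smul_apply, map_smul, extDerivAlong]

theorem neg_one_pow_smul_map_cons_removeNth (B : V [⋀^Fin (m + 1)]→L[ℝ] ℝ) (w : V)
    (v : Fin (m + 1) → V) (i : Fin (m + 1)) :
    (-1 : ℤ) ^ (i : ℕ) • B (Matrix.vecCons w (i.removeNth v)) = B (Function.update v i w) := by
  rw [← Fin.insertNth_removeNth]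
  exact (B.toAlternatingMap.map_insertNth i w (i.removeNth v)).symm

-- Cartan's formula for the contraction with the vector field `z ↦ S z`.
theorem extDerivAlong_curryLeft {β : V → V [⋀^Fin (m + 1)]→L[ℝ] ℝ} (h : DifferentiableAt ℝ β x) :
    extDerivAlong A (fun z => (β z).curryLeft (S z)) x =
      fderiv ℝ β x (A (S x)) + insertEndo (S.comp A) (β x) -
        (extDerivAlong A β x).curryLeft (S x) := by
  have hcurry : HasFDerivAt (fun z => (β z).curryLeft)
      ((curryLeftLI (𝕜 := ℝ)).toContinuousLinearMap.comp (fderiv ℝ β x)) x :=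
    (curryLeftLI (𝕜 := ℝ) (E := V) (F := ℝ)).toContinuousLinearMap.hasFDerivAt.comp x h.hasFDerivAt
  have hfderiv (w : V) (u : Fin m → V) :
      fderiv ℝ (fun z => (β z).curryLeft (S z)) x w u =
        β x (Matrix.vecCons (S w) u) + fderiv ℝ β x w (Matrix.vecCons (S x) u) := by
    rw [(hcurry.clm_apply S.hasFDerivAt).fderiv]
    simp
  ext v
  have hremove (i : Fin (m + 1)) : i.succ.removeNth (Matrix.vecCons (S x) v) =
      Matrix.vecCons (S x) (i.removeNth v) := Fin.cons_comp_succ_succAbove _ _ _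
  rw [ContinuousAlternatingMap.sub_apply, ContinuousAlternatingMap.add_apply,
    curryLeft_apply_apply, extDerivAlong_apply, extDerivAlong_apply, insertEndo_apply,
    Fin.sum_univ_succ (n := m + 1)]
  simp only [hfderiv, hremove, Fin.val_succ, pow_succ, mul_neg_one, neg_smul, smul_add,
    neg_one_pow_smul_map_cons_removeNth, Finset.sum_add_distrib, Finset.sum_neg_distrib]
  simp

theorem insertEndo_eq_smul {k : ℕ} {B : V [⋀^Fin k]→L[ℝ] ℝ} {p : V →L[ℝ] V} (hp : p.comp p = p)
    (hB : B.compContinuousLinearMap p = B) : insertEndo p B = (k : ℝ) • B := by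
  have hpp (w : V) : p (p w) = p w := congrArg (· w) hp
  ext v
  have hupdate (i : Fin k) : B (Function.update v i (p (v i))) = B v := by
    conv_rhs => rw [← hB]
    rw [← hB]
    refine congrArg B (funext fun j => ?_)
    by_cases hj : j = i <;> simp [hj, hpp]
  simp [insertEndo_apply, hupdate]

theorem extDerivAlong_intervalIntegral [FiniteDimensional ℝ V] {k : ℕ} {Ω : Set (V × ℝ)}
    {f : V × ℝ → V [⋀^Fin k]→L[ℝ] ℝ} {a b : ℝ} (hΩ : IsOpen Ω) (hf : ContDiffOn ℝ 1 f Ω)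
    (hx : ∀ s ∈ Set.uIcc a b, (x, s) ∈ Ω) :
    extDerivAlong A (fun y => ∫ s in a..b, f (y, s)) x =
      ∫ s in a..b, extDerivAlong A (fun y => f (y, s)) x := by
  have hf' : ContinuousOn (fun p => (fderiv ℝ f p).comp (ContinuousLinearMap.inl ℝ V ℝ)) Ω :=
    (hf.continuousOn_fderiv_of_isOpen hΩ le_rfl).clm_comp continuousOn_const
  have hslice (s : ℝ) (hs : s ∈ Set.uIcc a b) :
      fderiv ℝ (fun y => f (y, s)) x = (fderiv ℝ f (x, s)).comp (ContinuousLinearMap.inl ℝ V ℝ) :=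
    ((hf.contDiffAt (hΩ.mem_nhds (hx s hs))).differentiableAt one_ne_zero).hasFDerivAt.comp x
      (hasFDerivAt_prodMk_left x s) |>.fderiv
  rw [extDerivAlong, (hasFDerivAt_intervalIntegral_of_contDiffOn hΩ hf hx).fderiv,
    ← (alternatizeAlong k A).intervalIntegral_comp_comm (intervalIntegrable_slice hf' hx)]
  exact intervalIntegral.integral_congr fun s hs => by simp only [extDerivAlong, hslice s hs]

variable (A S) in
/-- The contraction `z ↦ z + (s - 1) A S z`: for a generalized inverse `S` of `A` it multiplies the
image of `A` by `s`. For `A = ∂/∂yⁱ ⊗ dxⁱ` it is the fibrewise scaling `(t, x, y) ↦ (t, x, s y)`. -/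
def scaleAlong (s : ℝ) : V →L[ℝ] V :=
  ContinuousLinearMap.id ℝ V + (s - 1) • A.comp S

theorem scaleAlong_apply (s : ℝ) (z : V) : scaleAlong A S s z = z + (s - 1) • A (S z) := rfl

theorem scaleAlong_one : scaleAlong A S 1 = ContinuousLinearMap.id ℝ V := by
  simp [scaleAlong]

theorem scaleAlong_comp (hA : (A.comp S).comp A = A) (s : ℝ) :
    (scaleAlong A S s).comp A = s • A := by
  rw [scaleAlong, ContinuousLinearMap.add_comp, ContinuousLinearMap.smul_comp, hA, sub_smul]
  simp

theorem hasDerivAt_scaleAlong (s : ℝ) :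
    HasDerivAt (fun s => scaleAlong A S s x) (A (S x)) s := by
  simpa [scaleAlong_apply] using
    (((hasDerivAt_id s).sub_const 1).smul_const (A (S x))).const_add x

theorem contDiff_scaleAlong : ContDiff ℝ ∞ fun p : V × ℝ => scaleAlong A S p.2 p.1 := by
  simp only [scaleAlong_apply]
  fun_prop

variable (A S) in
/-- The integrand of the homotopy operator. The factor `s ^ m` makes its image under `d_A` the
`s`-derivative of `s ^ (m + 1) • β (scaleAlong A S s x)`. -/
def homotopyIntegrand (β : V → V [⋀^Fin (m + 1)]→L[ℝ] ℝ) (p : V × ℝ) : V [⋀^Fin m]→L[ℝ] ℝ :=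
  p.2 ^ m • (β (scaleAlong A S p.2 p.1)).curryLeft (S p.1)

variable (A S) in
/-- The homotopy operator of `d_A`: a right inverse of `d_A` on `d_A`-closed forms that do not
change under `S ∘ A`. -/
def homotopyOp (β : V → V [⋀^Fin (m + 1)]→L[ℝ] ℝ) (x : V) : V [⋀^Fin m]→L[ℝ] ℝ :=
  ∫ s in (0 : ℝ)..1, homotopyIntegrand A S β (x, s)

theorem extDerivAlong_homotopyIntegrand {β : V → V [⋀^Fin (m + 1)]→L[ℝ] ℝ} {s : ℝ}
    (hA : (A.comp S).comp A = A) (h : DifferentiableAt ℝ β (scaleAlong A S s x))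
    (hSA : (β (scaleAlong A S s x)).compContinuousLinearMap (S.comp A) =
      β (scaleAlong A S s x))
    (hclosed : extDerivAlong A β (scaleAlong A S s x) = 0) :
    extDerivAlong A (fun y => homotopyIntegrand A S β (y, s)) x =
      s ^ (m + 1) • fderiv ℝ β (scaleAlong A S s x) (A (S x)) +
        ((m + 1) * s ^ m) • β (scaleAlong A S s x) := by
  let γ : V → V [⋀^Fin (m + 1)]→L[ℝ] ℝ := fun y => β (scaleAlong A S s y)
  have hγ : HasFDerivAt γ ((fderiv ℝ β (scaleAlong A S s x)).comp (scaleAlong A S s)) x :=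
    h.hasFDerivAt.comp x (scaleAlong A S s).hasFDerivAt
  have hγA : fderiv ℝ γ x (A (S x)) = s • fderiv ℝ β (scaleAlong A S s x) (A (S x)) := by
    have := congrArg (· (S x)) (scaleAlong_comp hA s)
    simp_all [hγ.fderiv]
  have hγclosed : extDerivAlong A γ x = 0 := by
    rw [extDerivAlong_comp_clm (scaleAlong_comp hA s) h, hclosed, smul_zero]
  have hidem : (S.comp A).comp (S.comp A) = S.comp A := by
    rw [ContinuousLinearMap.comp_assoc, ← ContinuousLinearMap.comp_assoc A, hA]
  have hinsert : insertEndo (S.comp A) (γ x) = ((m + 1 : ℕ) : ℝ) • γ x :=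
    insertEndo_eq_smul hidem hSA
  have hderiv : extDerivAlong A (fun y => (γ y).curryLeft (S y)) x =
      s • fderiv ℝ β (scaleAlong A S s x) (A (S x)) + ((m : ℝ) + 1) • γ x := by
    rw [extDerivAlong_curryLeft hγ.differentiableAt, hγA, hinsert, hγclosed]
    simp [curryLeft_zero]
  calc extDerivAlong A (fun y => homotopyIntegrand A S β (y, s)) x
      = s ^ m • extDerivAlong A (fun y => (γ y).curryLeft (S y)) x :=
        extDerivAlong_const_smul (s ^ m) fun y => (γ y).curryLeft (S y)
    _ = _ := by
        rw [hderiv, smul_add, smul_smul, smul_smul, pow_succ, mul_comm (s ^ m) ((m : ℝ) + 1)]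

theorem hasDerivAt_pow_smul_scaleAlong {β : V → V [⋀^Fin (m + 1)]→L[ℝ] ℝ} {s : ℝ}
    (h : DifferentiableAt ℝ β (scaleAlong A S s x)) :
    HasDerivAt (fun s : ℝ => s ^ (m + 1) • β (scaleAlong A S s x))
      (s ^ (m + 1) • fderiv ℝ β (scaleAlong A S s x) (A (S x)) +
        ((m + 1) * s ^ m) • β (scaleAlong A S s x)) s := by
  have hβ := h.hasFDerivAt.comp_hasDerivAt s (hasDerivAt_scaleAlong s)
  refine ((hasDerivAt_pow (m + 1) s).smul hβ).congr_deriv ?_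
  simp

variable {U : Set V} {β : V → V [⋀^Fin (m + 1)]→L[ℝ] ℝ}

theorem isOpen_preimage_scaleAlong (hU : IsOpen U) :
    IsOpen {p : V × ℝ | scaleAlong A S p.2 p.1 ∈ U} :=
  hU.preimage contDiff_scaleAlong.continuous

theorem contDiffOn_homotopyIntegrand [FiniteDimensional ℝ V] (hβ : ContDiffOn ℝ ∞ β U) :
    ContDiffOn ℝ ∞ (homotopyIntegrand A S β) {p | scaleAlong A S p.2 p.1 ∈ U} := by
  refine contDiffOn_alternating_iff_apply.2 fun v => ?_
  have hscale : ContDiffOn ℝ ∞ (fun p : V × ℝ => β (scaleAlong A S p.2 p.1))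
      {p | scaleAlong A S p.2 p.1 ∈ U} :=
    hβ.comp contDiff_scaleAlong.contDiffOn fun p hp => hp
  have happly : ContDiffOn ℝ ∞
      (fun p : V × ℝ => β (scaleAlong A S p.2 p.1) (Matrix.vecCons (S p.1) v))
      {p | scaleAlong A S p.2 p.1 ∈ U} := contDiffOn_alternating_apply hscale fun i => ?_
  · exact (contDiff_snd.pow m).contDiffOn.mul happly
  refine Fin.cases ?_ (fun j => ?_) i
  · exact (S.contDiff.comp contDiff_fst).contDiffOn
  · exact contDiffOn_const

theorem contDiffOn_homotopyOp [FiniteDimensional ℝ V] (hU : IsOpen U)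
    (hstar : ∀ x ∈ U, ∀ s ∈ Set.Icc (0 : ℝ) 1, scaleAlong A S s x ∈ U)
    (hβ : ContDiffOn ℝ ∞ β U) : ContDiffOn ℝ ∞ (homotopyOp A S β) U := by
  refine contDiffOn_intervalIntegral hU (isOpen_preimage_scaleAlong hU) ?_
    (contDiffOn_homotopyIntegrand hβ)
  rw [Set.uIcc_of_le zero_le_one]
  exact fun p hp => hstar p.1 hp.1 p.2 hp.2

theorem integral_deriv_pow_smul_scaleAlong (hU : IsOpen U)
    (hx : ∀ s ∈ Set.uIcc (0 : ℝ) 1, scaleAlong A S s x ∈ U) (hβ : ContDiffOn ℝ ∞ β U) :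
    ∫ s in (0 : ℝ)..1, (s ^ (m + 1) • fderiv ℝ β (scaleAlong A S s x) (A (S x)) +
      ((m + 1) * s ^ m) • β (scaleAlong A S s x)) = β x := by
  have hscale : ContinuousOn (fun s => scaleAlong A S s x) (Set.uIcc 0 1) := by
    simp only [scaleAlong_apply]
    fun_prop
  have hfderiv : ContinuousOn (fun s => fderiv ℝ β (scaleAlong A S s x) (A (S x)))
      (Set.uIcc 0 1) :=
    ((hβ.continuousOn_fderiv_of_isOpen hU (by simp)).comp hscale hx).clm_apply continuousOn_const
  rw [intervalIntegral.integral_eq_sub_of_hasDerivAt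
    (f := fun s => s ^ (m + 1) • β (scaleAlong A S s x))]
  · simp [scaleAlong_one]
  · exact fun s hs => hasDerivAt_pow_smul_scaleAlong
      ((hβ.contDiffAt (hU.mem_nhds (hx s hs))).differentiableAt (by simp))
  · exact (((continuous_pow (m + 1)).continuousOn.smul hfderiv).add
      ((continuous_const.mul (continuous_pow m)).continuousOn.smul
        (hβ.continuousOn.comp hscale hx))).intervalIntegrable

theorem extDerivAlong_homotopyOp [FiniteDimensional ℝ V] (hA : (A.comp S).comp A = A)
    (hU : IsOpen U) (hstar : ∀ x ∈ U, ∀ s ∈ Set.Icc (0 : ℝ) 1, scaleAlong A S s x ∈ U)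
    (hβ : ContDiffOn ℝ ∞ β U)
    (hSA : ∀ x ∈ U, (β x).compContinuousLinearMap (S.comp A) = β x)
    (hclosed : ∀ x ∈ U, extDerivAlong A β x = 0) (hx : x ∈ U) :
    extDerivAlong A (homotopyOp A S β) x = β x := by
  have hmem (s : ℝ) (hs : s ∈ Set.uIcc 0 1) : scaleAlong A S s x ∈ U :=
    hstar x hx s (by rwa [Set.uIcc_of_le zero_le_one] at hs)
  calc extDerivAlong A (homotopyOp A S β) x
      = ∫ s in (0 : ℝ)..1, extDerivAlong A (fun y => homotopyIntegrand A S β (y, s)) x :=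
        extDerivAlong_intervalIntegral (isOpen_preimage_scaleAlong hU)
          ((contDiffOn_homotopyIntegrand hβ).of_le (by simp)) hmem
    _ = ∫ s in (0 : ℝ)..1, (s ^ (m + 1) • fderiv ℝ β (scaleAlong A S s x) (A (S x)) +
          ((m + 1) * s ^ m) • β (scaleAlong A S s x)) :=
        intervalIntegral.integral_congr fun s hs => extDerivAlong_homotopyIntegrand hA
          ((hβ.contDiffAt (hU.mem_nhds (hmem s hs))).differentiableAt (by simp))
          (hSA _ (hmem s hs)) (hclosed _ (hmem s hs))
    _ = β x := integral_deriv_pow_smul_scaleAlong hU hmem hβ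

theorem exists_eqOnKer_extDerivAlong [FiniteDimensional ℝ V] {α : V →L[ℝ] ℝ}
    (hA : (A.comp S).comp A = A) (hα : α.comp (S.comp A) = 0) (hU : IsOpen U)
    (hstar : ∀ x ∈ U, ∀ s ∈ Set.Icc (0 : ℝ) 1, scaleAlong A S s x ∈ U)
    (hβ : ContDiffOn ℝ ∞ β U)
    (hsb : ∀ x ∈ U, ∀ v i, α (v i) = 0 → A (v i) = 0 → β x v = 0)
    (hclosed : ∀ x ∈ U, EqOnKer α (extDerivAlong A β x) 0) :
    ∃ H : V → V [⋀^Fin m]→L[ℝ] ℝ, ContDiffOn ℝ ∞ H U ∧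
      ∀ x ∈ U, EqOnKer α (β x) (extDerivAlong A H x) := by
  let p : V →L[ℝ] V := S.comp A
  have hAp : A.comp p = A := by rw [← ContinuousLinearMap.comp_assoc, hA]
  have hAp' (w : V) : A (p w) = A w := congrArg (· w) hAp
  have hαp (w : V) : α (p w) = 0 := congrArg (· w) hα
  let β' : V → V [⋀^Fin (m + 1)]→L[ℝ] ℝ := fun z => (β z).compContinuousLinearMap p
  have hβ' : ContDiffOn ℝ ∞ β' U := contDiffOn_alternating_comp hβ contDiffOn_const
  have hββ' (x : V) (hx : x ∈ U) : EqOnKer α (β x) (β' x) := fun v hv =>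
    map_eq_of_forall_sub_mem (K := α.ker ⊓ A.ker)
      (fun w i hw => hsb x hx w i hw.1 hw.2) fun i => by simp [hv, hαp, hAp']
  have hpp : p.comp p = p := by rw [ContinuousLinearMap.comp_assoc, hAp]
  have hβ'p (x : V) (_ : x ∈ U) : (β' x).compContinuousLinearMap p = β' x := by
    change (β x).compContinuousLinearMap (p.comp p) = _
    rw [hpp]
  have hclosed' (x : V) (hx : x ∈ U) : extDerivAlong A β' x = 0 := by
    have hd : DifferentiableAt ℝ β x := (hβ.contDiffAt (hU.mem_nhds hx)).differentiableAt (by simp)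
    rw [extDerivAlong_comp hd hAp]
    ext v
    exact hclosed x hx _ fun i => hαp (v i)
  refine ⟨homotopyOp A S β', contDiffOn_homotopyOp hU hstar hβ', fun x hx => ?_⟩
  rw [extDerivAlong_homotopyOp hA hU hstar hβ' hβ'p hclosed' hx]
  exact hββ' x hx

end Homotopy

/-! ### Forms on manifolds in charts -/

section Charts

variable {V : Type*} [NormedAddCommGroup V] [NormedSpace ℝ V] {P : Type*} [TopologicalSpace P]
  [ChartedSpace V P] {k : ℕ} {φ ψ : OpenPartialHomeomorph P V} {η : FormField V P k}
  {A : EndoField V P} {K : V → V →L[ℝ] V} {U : Set P} {u : P}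

theorem formInChart_comp_mvfderiv (hφ : φ.MDifferentiable 𝓘(ℝ, V) 𝓘(ℝ, V)) (η : FormField V P k)
    (hu : u ∈ φ.source) :
    (formInChart φ η (φ u)).compContinuousLinearMap (mvfderiv 𝓘(ℝ, V) φ u) = η u := by
  have apply_congr {u' : P} (h : u' = u) (L : V →L[ℝ] V) (v : Fin k → V) :
      η u' (fun i => L (v i)) = η u (fun i => L (v i)) := by subst h; rfl
  ext v
  refine (apply_congr (φ.left_inv hu) (mfderiv 𝓘(ℝ, V) 𝓘(ℝ, V) φ.symm (φ u))
    fun i => mfderiv 𝓘(ℝ, V) 𝓘(ℝ, V) φ u (v i)).trans (congrArg (η u) (funext fun i => ?_))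
  exact congrArg (· (v i)) (hφ.symm_comp_deriv hu)

theorem formInChart_eq_iff (hφ : φ.MDifferentiable 𝓘(ℝ, V) 𝓘(ℝ, V)) (hu : u ∈ φ.source)
    {C : V [⋀^Fin k]→L[ℝ] ℝ} :
    formInChart φ η (φ u) = C ↔ η u = C.compContinuousLinearMap (mvfderiv 𝓘(ℝ, V) φ u) := by
  refine ⟨fun h => h ▸ (formInChart_comp_mvfderiv hφ η hu).symm, fun h => ?_⟩
  rw [← formInChart_comp_mvfderiv hφ η hu] at h
  ext v
  obtain ⟨w, rfl⟩ := (hφ.mfderiv_surjective hu).comp_left v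
  exact congrArg (· w) h

theorem formInChart_insertField (hφ : φ.MDifferentiable 𝓘(ℝ, V) 𝓘(ℝ, V)) (hu : u ∈ φ.source)
    (hA : (mvfderiv 𝓘(ℝ, V) φ u).comp (A u) = (K (φ u)).comp (mvfderiv 𝓘(ℝ, V) φ u))
    (η : FormField V P k) :
    formInChart φ (insertField A η) (φ u) = insertEndo (K (φ u)) (formInChart φ η (φ u)) := by
  rw [formInChart_eq_iff hφ hu, ← insertEndo_compContinuousLinearMap hA,
    formInChart_comp_mvfderiv hφ η hu, insertField]

theorem mvfderiv_eq_fderiv_transition_comp (hφ : φ.MDifferentiable 𝓘(ℝ, V) 𝓘(ℝ, V))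
    (hψ : ψ.MDifferentiable 𝓘(ℝ, V) 𝓘(ℝ, V)) (huφ : u ∈ φ.source) (huψ : u ∈ ψ.source) :
    mvfderiv 𝓘(ℝ, V) φ u =
      (fderiv ℝ (φ ∘ ψ.symm) (ψ u)).comp (mvfderiv 𝓘(ℝ, V) ψ u) := by
  have hτ : MDifferentiableAt 𝓘(ℝ, V) 𝓘(ℝ, V) (φ ∘ ψ.symm) (ψ u) :=
    (hφ.mdifferentiableAt (by rwa [ψ.left_inv huψ])).comp _
      (hψ.mdifferentiableAt_symm (ψ.map_source huψ))
  have hcomp : (φ : P → V) =ᶠ[𝓝 u] (φ ∘ ψ.symm) ∘ ψ := by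
    filter_upwards [ψ.open_source.mem_nhds huψ] with w hw using congrArg φ (ψ.left_inv hw).symm
  have hchain := mfderiv_comp u hτ (hψ.mdifferentiableAt huψ)
  rw [mfderiv_eq_fderiv] at hchain
  exact (hcomp.mfderiv_eq (I := 𝓘(ℝ, V)) (I' := 𝓘(ℝ, V))).trans hchain

theorem formInChart_eq_pullback (hφ : φ.MDifferentiable 𝓘(ℝ, V) 𝓘(ℝ, V))
    (hψ : ψ.MDifferentiable 𝓘(ℝ, V) 𝓘(ℝ, V)) (η : FormField V P k) {z : V}
    (hz : z ∈ ψ.target ∩ ψ.symm ⁻¹' φ.source) :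
    formInChart ψ η z = (formInChart φ η ((φ ∘ ψ.symm) z)).compContinuousLinearMap
      (fderiv ℝ (φ ∘ ψ.symm) z) := by
  obtain ⟨u, hu, rfl⟩ : ∃ u ∈ ψ.source, ψ u = z := ⟨_, ψ.map_target hz.1, ψ.right_inv hz.1⟩
  have huφ : u ∈ φ.source := by simpa [hu] using hz.2
  rw [formInChart_eq_iff hψ hu, Function.comp_apply, ψ.left_inv hu,
    ← formInChart_comp_mvfderiv hφ η huφ, mvfderiv_eq_fderiv_transition_comp hφ hψ huφ hu]
  rfl

theorem SmoothFormOn.contDiffAt (hη : SmoothFormOn η U) (hφ : φ ∈ atlas V P) (hu : u ∈ φ.source)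
    (hU : U ∈ 𝓝 u) : ContDiffAt ℝ ∞ (formInChart φ η) (φ u) :=
  (hη φ hφ).contDiffAt <| Filter.inter_mem (φ.open_target.mem_nhds (φ.map_source hu))
    (φ.tendsto_symm hu hU)

variable [IsManifold 𝓘(ℝ, V) ∞ P]

theorem mdifferentiable_of_mem_smooth_atlas (hφ : φ ∈ atlas V P) :
    φ.MDifferentiable 𝓘(ℝ, V) 𝓘(ℝ, V) :=
  have : IsManifold 𝓘(ℝ, V) 1 P := .of_le (n := ∞) (by simp)
  mdifferentiable_of_mem_atlas hφ

theorem contDiffOn_chart_transition (hφ : φ ∈ atlas V P) (hψ : ψ ∈ atlas V P) :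
    ContDiffOn ℝ ∞ (φ ∘ ψ.symm) (ψ.target ∩ ψ.symm ⁻¹' φ.source) := by
  have hφ' := contMDiffOn_of_mem_maximalAtlas (I := 𝓘(ℝ, V)) (n := ∞)
    (IsManifold.subset_maximalAtlas hφ)
  have hψ' := contMDiffOn_symm_of_mem_maximalAtlas (I := 𝓘(ℝ, V)) (n := ∞)
    (IsManifold.subset_maximalAtlas hψ)
  exact (hφ'.comp (hψ'.mono Set.inter_subset_left) fun _ hz => hz.2).contDiffOn

theorem formInChart_extD (hη : SmoothFormOn η U) (hφ : φ ∈ atlas V P) (hu : u ∈ φ.source)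
    (hU : U ∈ 𝓝 u) :
    formInChart φ (extD η) (φ u) = extDeriv (formInChart φ η) (φ u) := by
  have hφd := mdifferentiable_of_mem_smooth_atlas hφ
  rw [formInChart_eq_iff hφd hu, extD]
  obtain ⟨ψ, hψu⟩ : ∃ ψ, ψ = chartAt V u := ⟨_, rfl⟩
  rw [← hψu]
  have hψ : ψ ∈ atlas V P := hψu ▸ chart_mem_atlas V u
  have huψ : u ∈ ψ.source := hψu ▸ mem_chart_source V u
  have hψd := mdifferentiable_of_mem_smooth_atlas hψ
  have hz : ψ.target ∩ ψ.symm ⁻¹' φ.source ∈ 𝓝 (ψ u) :=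
    (ψ.symm.isOpen_inter_preimage φ.open_source).mem_nhds
      ⟨ψ.map_source huψ, by rwa [Set.mem_preimage, ψ.left_inv huψ]⟩
  have hτ : ContDiffAt ℝ ∞ (φ ∘ ψ.symm) (ψ u) := (contDiffOn_chart_transition hφ hψ).contDiffAt hz
  have hτu : (φ ∘ ψ.symm) (ψ u) = φ u := congrArg φ (ψ.left_inv huψ)
  have hd : DifferentiableAt ℝ (formInChart φ η) ((φ ∘ ψ.symm) (ψ u)) :=
    hτu ▸ (hη.contDiffAt hφ hu hU).differentiableAt (by simp)
  have hpull : formInChart ψ η =ᶠ[𝓝 (ψ u)] fun z =>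
      (formInChart φ η ((φ ∘ ψ.symm) z)).compContinuousLinearMap (fderiv ℝ (φ ∘ ψ.symm) z) :=
    Filter.mem_of_superset hz fun z hz => formInChart_eq_pullback hφd hψd η hz
  have hr : minSmoothness ℝ 2 ≤ ∞ := by
    rw [minSmoothness_of_isRCLikeNormedField]; exact ENat.LEInfty.out
  rw [hpull.extDeriv_eq, extDeriv_pullback hd hτ hr, hτu,
    mvfderiv_eq_fderiv_transition_comp hφd hψd hu huψ]
  rfl

theorem formInChart_extDAlong (hη : SmoothFormOn η U) (hAη : SmoothFormOn (insertField A η) U)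
    (hφ : φ ∈ atlas V P) (hA : ∀ w ∈ φ.source,
      (mvfderiv 𝓘(ℝ, V) φ w).comp (A w) = (K (φ w)).comp (mvfderiv 𝓘(ℝ, V) φ w))
    (hu : u ∈ φ.source) (hU : U ∈ 𝓝 u) :
    formInChart φ (extDAlong A η) (φ u) =
      insertEndo (K (φ u)) (extDeriv (formInChart φ η) (φ u)) -
        extDeriv (fun z => insertEndo (K z) (formInChart φ η z)) (φ u) := by
  have hφd := mdifferentiable_of_mem_smooth_atlas hφ
  have hins : formInChart φ (insertField A η) =ᶠ[𝓝 (φ u)]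
      fun z => insertEndo (K z) (formInChart φ η z) := by
    filter_upwards [φ.open_target.mem_nhds (φ.map_source hu)] with z hz
    simpa only [φ.right_inv hz] using
      formInChart_insertField hφd (φ.map_target hz) (hA _ (φ.map_target hz)) η
  rw [← hins.extDeriv_eq, ← formInChart_extD hη hφ hu hU, ← formInChart_extD hAη hφ hu hU,
    ← formInChart_insertField hφd hu (hA u hu)]
  rfl

theorem smoothFormOn_source [FiniteDimensional ℝ V] (hφ : φ ∈ atlas V P)
    (h : ContDiffOn ℝ ∞ (formInChart φ η) φ.target) : SmoothFormOn η φ.source := by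
  intro ψ hψ
  have hτ := contDiffOn_chart_transition hφ hψ
  have hopen := ψ.symm.isOpen_inter_preimage φ.open_source
  exact (contDiffOn_alternating_comp (h.comp hτ fun z hz => φ.map_source hz.2)
    (hτ.fderiv_of_isOpen hopen (by simp))).congr fun z hz =>
      formInChart_eq_pullback (mdifferentiable_of_mem_smooth_atlas hφ)
        (mdifferentiable_of_mem_smooth_atlas hψ) η hz

end Charts

/-! ### The derivation `d_J` in induced charts -/

section Model

variable (n : ℕ)

/-- The constant endomorphism `∂/∂yⁱ ⊗ dxⁱ`, which agrees with the vertical endomorphism on the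
kernel of `dt`. -/
def vertA : JetModel n →L[ℝ] JetModel n :=
  (ContinuousLinearMap.inr ℝ (BaseModel n) (EuclideanSpace ℝ (Fin n))).comp
    ((ContinuousLinearMap.snd ℝ ℝ (EuclideanSpace ℝ (Fin n))).comp
      (ContinuousLinearMap.fst ℝ (BaseModel n) (EuclideanSpace ℝ (Fin n))))

/-- The constant endomorphism `∂/∂xⁱ ⊗ dyⁱ`, which inverts `vertA` on vertical vectors. -/
def horLift : JetModel n →L[ℝ] JetModel n :=
  (ContinuousLinearMap.inl ℝ (BaseModel n) (EuclideanSpace ℝ (Fin n))).comp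
    ((ContinuousLinearMap.inr ℝ ℝ (EuclideanSpace ℝ (Fin n))).comp
      (ContinuousLinearMap.snd ℝ (BaseModel n) (EuclideanSpace ℝ (Fin n))))

/-- The coordinate form `dt`. -/
def modelDt : JetModel n →L[ℝ] ℝ :=
  (ContinuousLinearMap.fst ℝ ℝ (EuclideanSpace ℝ (Fin n))).comp
    (ContinuousLinearMap.fst ℝ (BaseModel n) (EuclideanSpace ℝ (Fin n)))

variable {n}

theorem vertA_apply (v : JetModel n) : vertA n v = (0, v.1.2) := rfl

theorem modelDt_apply (v : JetModel n) : modelDt n v = v.1.1 := rfl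

theorem modelJ_eq_vertA (y : EuclideanSpace ℝ (Fin n)) {v : JetModel n} (hv : modelDt n v = 0) :
    modelJ y v = vertA n v := by
  rw [modelDt_apply] at hv
  simp [modelJ_apply, vertA_apply, hv]

theorem contDiff_modelJ : ContDiff ℝ ∞ fun z : JetModel n => modelJ z.2 := by
  refine contDiff_clm_apply_iff.2 fun v => ?_
  simp only [modelJ_apply]
  fun_prop

theorem exists_eqOnKer_extDerivAlong_vertA {m : ℕ} {U : Set (BaseModel n)} (hU : IsOpen U)
    {β : JetModel n → JetModel n [⋀^Fin (m + 1)]→L[ℝ] ℝ}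
    (hβ : ContDiffOn ℝ ∞ β (Prod.fst ⁻¹' U))
    (hsb : ∀ z, z.1 ∈ U → ∀ v i, (v i).1 = 0 → β z v = 0)
    (hclosed : ∀ z, z.1 ∈ U → EqOnKer (modelDt n) (extDerivAlong (vertA n) β z) 0) :
    ∃ H : JetModel n → JetModel n [⋀^Fin m]→L[ℝ] ℝ, ContDiffOn ℝ ∞ H (Prod.fst ⁻¹' U) ∧
      ∀ z, z.1 ∈ U → EqOnKer (modelDt n) (β z) (extDerivAlong (vertA n) H z) := by
  refine exists_eqOnKer_extDerivAlong (S := horLift n) rfl rfl (hU.preimage continuous_fst)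
    (fun z hz s _ => ?_) hβ (fun z hz v i ht hx => hsb z hz v i (Prod.ext ht ?_)) hclosed
  · simpa [scaleAlong_apply, vertA_apply] using hz
  · exact congrArg (fun w : JetModel n => w.2) hx

end Model

section JetCharts

variable {n : ℕ} {M : Type*} [TopologicalSpace M] [ChartedSpace (BaseModel n) M]
  [IsManifold 𝓘(ℝ, BaseModel n) ∞ M] {π : FibredOverReal n M} {k : ℕ}
  {e : OpenPartialHomeomorph M (BaseModel n)} {η η' : FormField (JetModel n) (Jet π) k}
  {U : Set (Jet π)} {u : Jet π}

theorem jetChart_mem_atlas (he : IsFibredChart π e) :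
    jetChart e he ∈ atlas (JetModel n) (Jet π) := ⟨e, he, rfl⟩

theorem jetChart_mdifferentiable (he : IsFibredChart π e) :
    (jetChart e he).MDifferentiable 𝓘(ℝ, JetModel n) 𝓘(ℝ, JetModel n) :=
  mdifferentiable_of_mem_smooth_atlas (jetChart_mem_atlas he)

theorem formInChart_insertField_vertEndo (he : IsFibredChart π e)
    (η : FormField (JetModel n) (Jet π) k) {z : JetModel n} (hz : z ∈ (jetChart e he).target) :
    formInChart (jetChart e he) (insertField (vertEndo π) η) z =
      insertEndo (modelJ z.2) (formInChart (jetChart e he) η z) := by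
  have h := formInChart_insertField (K := fun z => modelJ z.2) (jetChart_mdifferentiable he)
    ((jetChart e he).map_target hz) (vertEndo_eq he _ ((jetChart e he).map_target hz)) η
  rwa [(jetChart e he).right_inv hz] at h

theorem SmoothFormOn.insertField_vertEndo (hη : SmoothFormOn η U) :
    SmoothFormOn (insertField (vertEndo π) η) U := by
  rintro _ ⟨e, he, rfl⟩
  exact (contDiffOn_insertEndo (hη _ (jetChart_mem_atlas he)) contDiff_modelJ.contDiffOn).congr
    fun z hz => formInChart_insertField_vertEndo he η hz.1

theorem eqOnKer_formInChart_extDAlong (he : IsFibredChart π e) (hη : SmoothFormOn η U)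
    (hu : u ∈ (jetChart e he).source) (hU : U ∈ 𝓝 u) :
    EqOnKer (modelDt n) (formInChart (jetChart e he) (extDAlong (vertEndo π) η) (jetChart e he u))
      (extDerivAlong (vertA n) (formInChart (jetChart e he) η) (jetChart e he u)) := by
  have hφ := jetChart_mem_atlas he
  have hη' := (hη.contDiffAt hφ hu hU).differentiableAt (by simp)
  have hinsert : DifferentiableAt ℝ
      (fun z => insertEndo (modelJ z.2) (formInChart (jetChart e he) η z)) (jetChart e he u) := by
    refine ((hη.insertField_vertEndo.contDiffAt hφ hu hU).differentiableAt
      (by simp)).congr_of_eventuallyEq ?_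
    filter_upwards [(jetChart e he).open_target.mem_nhds ((jetChart e he).map_source hu)] with z hz
      using (formInChart_insertField_vertEndo he η hz).symm
  have hchart := formInChart_extDAlong (K := fun z => modelJ z.2) hη hη.insertField_vertEndo hφ
    (fun w hw => vertEndo_eq he w hw) hu hU
  rw [hchart]
  exact eqOnKer_extDerivAlong (J := fun z : JetModel n => modelJ z.2)
    (fun z v hv => modelJ_eq_vertA z.2 hv) hη' hinsert

theorem dt_eq (he : IsFibredChart π e) (hu : u ∈ (jetChart e he).source) :
    dt π u = (modelDt n).comp (mvfderiv 𝓘(ℝ, JetModel n) (jetChart e he) u) := by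
  have ht : (fun w : Jet π => π.proj w.base) =ᶠ[𝓝 u] modelDt n ∘ jetChart e he := by
    filter_upwards [(jetChart e he).open_source.mem_nhds hu] with w hw using (he.2 _ hw).symm
  have hchain := mfderiv_comp (I' := 𝓘(ℝ, JetModel n)) (I'' := 𝓘(ℝ, ℝ)) u
    (modelDt n).differentiableAt.mdifferentiableAt
    ((jetChart_mdifferentiable he).mdifferentiableAt hu)
  rw [mfderiv_eq_fderiv, ContinuousLinearMap.fderiv] at hchain
  exact (ht.mfderiv_eq (I := 𝓘(ℝ, JetModel n)) (I' := 𝓘(ℝ, ℝ))).trans hchain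

theorem mvfderiv_jetChart_surjective (he : IsFibredChart π e) (hu : u ∈ (jetChart e he).source) :
    Function.Surjective (mvfderiv 𝓘(ℝ, JetModel n) (jetChart e he) u) :=
  (jetChart_mdifferentiable he).mfderiv_surjective hu

theorem dt_ne_zero (u : Jet π) : dt π u ≠ 0 := fun h => by
  obtain ⟨e, he, hu⟩ := exists_isFibredChart π u.base
  obtain ⟨X, hX⟩ := mvfderiv_jetChart_surjective (u := u) he hu ((1, 0), 0)
  rw [dt_eq he hu] at h
  simpa [hX, modelDt_apply] using congrArg (· X) h

theorem mfderiv_base_eq (he : IsFibredChart π e) (hu : u ∈ (jetChart e he).source) :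
    mfderiv 𝓘(ℝ, JetModel n) 𝓘(ℝ, BaseModel n) Jet.base u =
      (mfderiv 𝓘(ℝ, BaseModel n) 𝓘(ℝ, BaseModel n) e.symm (jetChart e he u).1).comp
        ((ContinuousLinearMap.fst ℝ (BaseModel n) (EuclideanSpace ℝ (Fin n))).comp
          (mvfderiv 𝓘(ℝ, JetModel n) (jetChart e he) u)) := by
  have hbase : (Jet.base : Jet π → M) =ᶠ[𝓝 u]
      e.symm ∘ (ContinuousLinearMap.fst ℝ (BaseModel n) (EuclideanSpace ℝ (Fin n)) ∘
        jetChart e he) := by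
    filter_upwards [(jetChart e he).open_source.mem_nhds hu] with w hw
    exact (e.left_inv hw).symm
  have hφ := (jetChart_mdifferentiable he).mdifferentiableAt hu
  have hfst : MDifferentiableAt 𝓘(ℝ, JetModel n) 𝓘(ℝ, BaseModel n)
      (ContinuousLinearMap.fst ℝ (BaseModel n) (EuclideanSpace ℝ (Fin n))) (jetChart e he u) :=
    (ContinuousLinearMap.differentiableAt _).mdifferentiableAt
  have hchain := mfderiv_comp u hfst hφ
  rw [mfderiv_eq_fderiv, ContinuousLinearMap.fderiv] at hchain
  rw [hbase.mfderiv_eq, mfderiv_comp (I' := 𝓘(ℝ, BaseModel n)) u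
    (he.mdifferentiable.mdifferentiableAt_symm (e.map_source hu)) (hfst.comp u hφ), hchain]
  rfl

theorem IsSemiBasic.formInChart_apply_eq_zero (hη : IsSemiBasic η) (he : IsFibredChart π e)
    (hu : u ∈ (jetChart e he).source) {v : Fin k → JetModel n} {i : Fin k} (hv : (v i).1 = 0) :
    formInChart (jetChart e he) η (jetChart e he u) v = 0 := by
  obtain ⟨X, rfl⟩ := (mvfderiv_jetChart_surjective he hu).comp_left v
  have hX : mfderiv 𝓘(ℝ, JetModel n) 𝓘(ℝ, BaseModel n) Jet.base u (X i) = 0 := by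
    rw [mfderiv_base_eq he hu]
    refine (congrArg (mfderiv 𝓘(ℝ, BaseModel n) 𝓘(ℝ, BaseModel n) e.symm _) hv).trans ?_
    exact map_zero _
  have h := hη u X i hX
  rw [← formInChart_comp_mvfderiv (jetChart_mdifferentiable he) η hu] at h
  exact h

theorem wedgeOne_dt_eq_iff (he : IsFibredChart π e) (hu : u ∈ (jetChart e he).source) :
    wedgeOne (η u) (dt π u) = wedgeOne (η' u) (dt π u) ↔
      EqOnKer (modelDt n) (formInChart (jetChart e he) η (jetChart e he u))
        (formInChart (jetChart e he) η' (jetChart e he u)) := by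
  have hφd := jetChart_mdifferentiable he
  rw [wedgeOne_eq_wedgeOne_iff (dt_ne_zero u), dt_eq he hu, ← formInChart_comp_mvfderiv hφd η hu,
    ← formInChart_comp_mvfderiv hφd η' hu]
  exact eqOnKer_compContinuousLinearMap_iff (mvfderiv_jetChart_surjective he hu)

theorem wedgeOne_dt_eq_zero_iff (he : IsFibredChart π e) (hu : u ∈ (jetChart e he).source) :
    wedgeOne (η u) (dt π u) = 0 ↔
      EqOnKer (modelDt n) (formInChart (jetChart e he) η (jetChart e he u)) 0 := by
  rw [← wedgeOne_zero (dt π u)]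
  exact wedgeOne_dt_eq_iff (η' := fun _ => 0) he hu

theorem wedgeOne_extDAlong_dt_eq_zero_iff (he : IsFibredChart π e) (hη : SmoothFormOn η U)
    (hu : u ∈ (jetChart e he).source) (hU : U ∈ 𝓝 u) :
    wedgeOne (extDAlong (vertEndo π) η u) (dt π u) = 0 ↔ EqOnKer (modelDt n)
      (extDerivAlong (vertA n) (formInChart (jetChart e he) η) (jetChart e he u)) 0 := by
  have h := eqOnKer_formInChart_extDAlong he hη hu hU
  exact (wedgeOne_dt_eq_zero_iff he hu).trans ⟨h.symm.trans, h.trans⟩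

theorem wedgeOne_dt_eq_wedgeOne_extDAlong_dt_iff {θ : FormField (JetModel n) (Jet π) (k + 1)}
    (he : IsFibredChart π e) (hη : SmoothFormOn η U) (hu : u ∈ (jetChart e he).source)
    (hU : U ∈ 𝓝 u) :
    wedgeOne (θ u) (dt π u) = wedgeOne (extDAlong (vertEndo π) η u) (dt π u) ↔
      EqOnKer (modelDt n) (formInChart (jetChart e he) θ (jetChart e he u))
        (extDerivAlong (vertA n) (formInChart (jetChart e he) η) (jetChart e he u)) := by
  have h := eqOnKer_formInChart_extDAlong he hη hu hU
  exact (wedgeOne_dt_eq_iff he hu).trans ⟨fun h' => h'.trans h, fun h' => h'.trans h.symm⟩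

end JetCharts

section Main

variable {n : ℕ} {M : Type*} [TopologicalSpace M] [ChartedSpace (BaseModel n) M]
  [IsManifold 𝓘(ℝ, BaseModel n) ∞ M] {π : FibredOverReal n M}

theorem IsExactModOn.isClosedMod {k : ℕ} {θ : FormField (JetModel n) (Jet π) k}
    (hθ : SmoothFormOn θ Set.univ) (hex : IsExactModOn (vertEndo π) (dt π) Set.univ θ) :
    IsClosedMod (vertEndo π) (dt π) θ := by
  intro u
  obtain ⟨e, he, hu⟩ := exists_isFibredChart π u.base
  set φ := jetChart e he
  have hφ : φ ∈ atlas (JetModel n) (Jet π) := jetChart_mem_atlas he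
  have hu : u ∈ φ.source := hu
  have hd := (hθ.contDiffAt hφ hu Filter.univ_mem).differentiableAt (by simp)
  have hnhds := φ.open_source.mem_nhds hu
  rw [wedgeOne_extDAlong_dt_eq_zero_iff he hθ hu Filter.univ_mem]
  cases k with
  | zero =>
    have hzero : ∀ᶠ z in 𝓝 (φ u), EqOnKer (modelDt n) (formInChart φ θ z) 0 :=
      (φ.eventually_nhds _ hu).2 <| Filter.mem_of_superset hnhds fun w hw =>
        (wedgeOne_dt_eq_zero_iff he hw).1 (hex w trivial)
    simpa [extDerivAlong] using EqOnKer.extDerivAlong hd (differentiableAt_const 0) hzero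
  | succ k =>
    obtain ⟨η, hη, hex⟩ := hex
    have hη' : ContDiffAt ℝ 2 (formInChart φ η) (φ u) :=
      (hη.contDiffAt hφ hu Filter.univ_mem).of_le ENat.LEInfty.out
    have hexact : ∀ᶠ z in 𝓝 (φ u), EqOnKer (modelDt n) (formInChart φ θ z)
        (extDerivAlong (vertA n) (formInChart φ η) z) :=
      (φ.eventually_nhds _ hu).2 <| Filter.mem_of_superset hnhds fun w hw =>
        (wedgeOne_dt_eq_wedgeOne_extDAlong_dt_iff he hη hw Filter.univ_mem).1 (hex w trivial)
    rw [← extDerivAlong_extDerivAlong hη']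
    exact EqOnKer.extDerivAlong hd (differentiableAt_extDerivAlong hη') hexact

theorem isExactModOn_jetChart_source {m : ℕ} {θ : FormField (JetModel n) (Jet π) (m + 1)}
    (hθ : SmoothFormOn θ Set.univ) (hsb : IsSemiBasic θ)
    (hcl : IsClosedMod (vertEndo π) (dt π) θ) {e : OpenPartialHomeomorph M (BaseModel n)}
    (he : IsFibredChart π e) : IsExactModOn (vertEndo π) (dt π) (jetChart e he).source θ := by
  set φ := jetChart e he
  have hφ : φ ∈ atlas (JetModel n) (Jet π) := jetChart_mem_atlas he
  have hlift (z : JetModel n) (hz : z.1 ∈ e.target) : ∃ u ∈ φ.source, φ u = z :=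
    ⟨_, φ.map_target hz, φ.right_inv hz⟩
  obtain ⟨H, hH, hθH⟩ := exists_eqOnKer_extDerivAlong_vertA (β := formInChart φ θ) e.open_target
    ((hθ φ hφ).mono fun z hz => ⟨hz, trivial⟩)
    (fun z hz v i hv => by
      obtain ⟨u, hu, rfl⟩ := hlift z hz
      exact hsb.formInChart_apply_eq_zero he hu hv)
    (fun z hz => by
      obtain ⟨u, hu, rfl⟩ := hlift z hz
      exact (wedgeOne_extDAlong_dt_eq_zero_iff he hθ hu Filter.univ_mem).1 (hcl u))
  let η : FormField (JetModel n) (Jet π) m := fun u =>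
    (H (φ u)).compContinuousLinearMap (mvfderiv 𝓘(ℝ, JetModel n) φ u)
  have hηH : Set.EqOn (formInChart φ η) H φ.target := fun z hz => by
    obtain ⟨u, hu, rfl⟩ := hlift z hz
    exact (formInChart_eq_iff (jetChart_mdifferentiable he) hu).2 rfl
  have hη : SmoothFormOn η φ.source := smoothFormOn_source hφ (hH.congr hηH)
  refine ⟨η, hη, fun u hu => ?_⟩
  rw [wedgeOne_dt_eq_wedgeOne_extDAlong_dt_iff he hη hu (φ.open_source.mem_nhds hu), extDerivAlong,
    (hηH.eventuallyEq_of_mem (φ.open_target.mem_nhds (φ.map_source hu))).fderiv_eq]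
  exact hθH _ (φ.map_source hu)

end Main

end JetForms

end

open JetForms in
theorem lemma2p4 {n : ℕ} {M : Type*} [TopologicalSpace M] [ChartedSpace (BaseModel n) M]
    [IsManifold 𝓘(ℝ, BaseModel n) ∞ M] (π : FibredOverReal n M) :
    (∀ (k : ℕ) (θ : FormField (JetModel n) (Jet π) k), SmoothFormOn θ Set.univ →
      IsExactModOn (vertEndo π) (dt π) Set.univ θ → IsClosedMod (vertEndo π) (dt π) θ) ∧
    (∀ (k : ℕ) (θ : FormField (JetModel n) (Jet π) k), 1 ≤ k → SmoothFormOn θ Set.univ →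
      IsSemiBasic θ → IsClosedMod (vertEndo π) (dt π) θ →
      ∀ u : Jet π, ∃ U : Set (Jet π), IsOpen U ∧ u ∈ U ∧
        IsExactModOn (vertEndo π) (dt π) U θ) := by
  refine ⟨fun k θ hθ hex => hex.isClosedMod hθ, fun k θ hk hθ hsb hcl u => ?_⟩
  obtain ⟨m, rfl⟩ : ∃ m, k = m + 1 := Nat.exists_eq_add_of_le' hk
  obtain ⟨e, he, hu⟩ := exists_isFibredChart π u.base
  exact ⟨(jetChart e he).source, (jetChart e he).open_source, hu,
    isExactModOn_jetChart_source hθ hsb hcl he⟩
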